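/- **Setting.** Objects of integral length at least $1$ are stored in an array with cells $0,1,2,\dots$. An online sequence of requests inserts objects (under names not in use) and deletes active objects. Let $\Delta$ be the length of the longest object inserted so far, let $V$ be the total length of the active objects (inserted and not deleted), and let $\varepsilon'>0$ be a parameter. Size class $i\ge 1$ consists of the lengths $w$ with $2^{i-1}\le w<2^i$. **Data structure.** The array is divided into regions $1,2,\dots,\lfloor\log_2\Delta\rfloor+1$, one per size class, followed by a *tail buffer*. Region $i$ is a payload segment (only objects of class $i$) followed by a buffer segment (only items of classes $\le i$). All segments are empty at the start. - *Insertion when no flush is in progress.* The object, of length $w$ and class $i$, is appended to the earliest buffer of a class $j\ge i$ with $w$ unoccupied cells, or to the tail buffer if there is none. If it does not fit there either, it is placed at the end of the contents of the tail buffer, beyond its capacity, and a flush is triggered. - *Deletion when no flush is in progress.* The object leaves a hole, and a delete record of its length and class is put into a buffer by the same rule. If the record fits nowhere, it is not stored and a flush is triggered. - *Flush.* Let $b$ be the largest class such that the triggering object and all items in the tail buffer and in the buffers of classes $\ge b$ have class $\ge b$. Let $V(i)$ and $V_f$ be the volume of the active objects of class $i$ and of all active objects at the start of the flush (with the triggering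 request taken into account). The goal is that, for each $i\ge b$, the $i$th payload segment has length $V(i)$ and contains all objects of class $i$, that the $i$th buffer is empty and of length $\lfloor\varepsilon' V(i)\rfloor$, and that the tail buffer is empty and of length $\lfloor\varepsilon' V_f\rfloor$. Let $S$ be the end of the contents of the array if the tail buffer is counted up to its last item, and $S'$ the end of the tail buffer in the goal layout. Let $L=S-w$ and $L'=S'-w$ if the flush is triggered by the insertion of an object of length $w$, and $L=S$, $L'=S'$ if it is triggered by a deletion. Let $B$ be the total length of the flushed buffers including the tail buffer, and $T=\max\{L,L'\}+B+\Delta$. Holes and delete records of the flushed segments are dropped. Then the objects of the flushed buffers are moved to consecutive places from $T$ on; the flushed payload objects are packed to the left of $T$, from the last one to the first one; these are moved to their final places, from the first one to the last one; and the objects that came from buffers are moved to the ends of their payload segments. The cells behind the temporary working space (which ends where the objects moved behind $T$ end) form the *log*. Requests that arrive during the flush are appended to the log, where an insertion or deletion of an object of length $w$ takes $w$ cells. Finally the items of the log are re-inserted or re-deleted, in order, by the above rules for buffers; when the end of the log is reached the flush is complete and the log disappears. (The last item may trigger the next flush.) - *Deamortization.* On each request for an object of length $w$ that arrives during a flush,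 the next steps of the flush are performed until their volume (total length of the items moved) exceeds $(4/\varepsilon')w$ or no flush is in progress. There are two variants of the work on a flush by the request that triggers it: *eager*, where this request also spends its amount of work $(4/\varepsilon')w$, or what is left of it, on the new flush; and *lazy*, where only the subsequent requests work on the new flush. In the lazy variant, an object whose deletion has triggered a flush counts as active in $V$ until this flush completes. The *total space used* is the smallest number $m$ such that all segments, all stored items and, while a flush is in progress, its temporary working space and log lie in the cells $0,\dots,m-1$. **Lemma.** There is an absolute constant $C>0$ such that for all $0<\varepsilon'\le 1/4$, in both variants, and for every sequence of requests, the following holds after each request is processed. The total space used by the data structure is at most $(1+C\varepsilon')V+\Delta$. If no flush is in progress, it is at most $(1+C\varepsilon')V$. -/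

import Mathlib

namespace StorageRealloc

/-! ### Requests, active objects -/

/-- An online request: allocate a new object with a given name and (integral) length, or
deallocate the active object with a given name. -/
inductive Request where
  | insert (name length : ℕ)
  | delete (name : ℕ)

/-- The list of active objects, as pairs (name, length). -/
abbrev Directory := List (ℕ × ℕ)

/-- The active objects after one more request. -/
def Directory.update (d : Directory) : Request → Directory
  | .insert n w => (n, w) :: d
  | .delete n => d.filter (fun p => p.1 ≠ n)

/-- The length of the active object called `n`. -/
def Directory.lengthOf (d : Directory) (n : ℕ) : ℕ := (d.lookup n).getD 0

/-- A request sequence is legal if every inserted object has length at least `1` and a name that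
is not in use, and if only active objects are deleted. -/
def ValidFrom : Directory → List Request → Prop
  | _, [] => True
  | d, .insert n w :: rs =>
      1 ≤ w ∧ n ∉ d.map Prod.fst ∧ ValidFrom (d.update (.insert n w)) rs
  | d, .delete n :: rs => n ∈ d.map Prod.fst ∧ ValidFrom (d.update (.delete n)) rs

/-- A legal sequence of requests, starting with no objects. -/
def Valid (rs : List Request) : Prop := ValidFrom [] rs

/-- The total length `V` of the objects that are active after the requests `rs`. -/
def activeVolume (rs : List Request) : ℕ :=
  ((rs.foldl Directory.update []).map Prod.snd).sum

/-- The maximum of `Δ` and the length of the object in an insertion. -/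
def Request.maxLength (Δ : ℕ) : Request → ℕ
  | .insert _ w => max Δ w
  | .delete _ => Δ

/-- The length `Δ` of the longest object inserted by the requests `rs`. -/
def longest (rs : List Request) : ℕ := rs.foldl Request.maxLength 0

/-- The size class of an object of length `w ≥ 1`: the number `i` with `2^(i-1) ≤ w < 2^i`. -/
def sizeClass (w : ℕ) : ℕ := Nat.size w

/-! ### The contents of the array -/

/-- What an item stored in the array is: an object, an object whose deletion has been carried out
but whose cells have not been reclaimed yet (a hole), or a dummy delete record. -/
inductive Kind where
  | live
  | dead
  | record
  deriving DecidableEq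

/-- An item occupies the cells `addr, …, addr + size - 1`. -/
structure Item where
  name : ℕ
  size : ℕ
  addr : ℕ
  kind : Kind

/-- The total size of a list of items. -/
def vol (l : List Item) : ℕ := (l.map Item.size).sum

/-- The live objects in a list of items. -/
def live (l : List Item) : List Item := l.filter (fun x => x.kind = .live)

/-- The items of size class `i` in a list. -/
def ofClass (i : ℕ) (l : List Item) : List Item := l.filter (fun x => sizeClass x.size = i)

/-- The largest end point of an item in a list. -/
def lastCell (l : List Item) : ℕ := (l.map (fun x => x.addr + x.size)).foldr max 0

/-- The region of a size class: a payload segment of length `payCap` followed by a buffer segment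
of length `bufCap`, with their contents. -/
structure Region where
  payCap : ℕ
  bufCap : ℕ
  payload : List Item
  buffer : List Item

/-- The instruction to move the object `name`, of length `size`, to the address `target`. -/
structure Move where
  name : ℕ
  size : ℕ
  target : ℕ

/-- The plan of a flush: the boundary size class, the volumes `V(i)` and their sum `V_f` at the
start of the flush, and the moves that are still to be carried out. -/
structure Plan where
  boundary : ℕ
  classVol : ℕ → ℕ
  totalVol : ℕ
  moves : List Move

/-- Either no flush is in progress, or a flush is moving the objects it found, or it is moving the
contents of the log to the buffers. -/
inductive Phase where
  | idle
  | moving (p : Plan)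
  | draining

/-- No flush is in progress. -/
def Phase.IsIdle : Phase → Prop
  | .idle => True
  | _ => False

/-- The state of the data structure.  The regions of the size classes `1, 2, …` follow each other
from address `0` on, and the tail buffer follows them.  `overflow` holds the objects that a flush
has taken over from the buffers.  The log occupies the cells `logStart, …, logEnd - 1`; `log` is
the part of it that is not yet processed.  `pending` is the length of the object whose deletion
triggered the flush in progress (`0` if there is none). -/
structure State where
  active : Directory
  maxLen : ℕ
  region : ℕ → Region
  tailCap : ℕ
  tail : List Item
  phase : Phase
  overflow : List Item
  log : List Item
  logStart : ℕ
  logEnd : ℕ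
  pending : ℕ

/-- The empty data structure. -/
def State.init : State where
  active := []
  maxLen := 0
  region := fun _ => ⟨0, 0, [], []⟩
  tailCap := 0
  tail := []
  phase := .idle
  overflow := []
  log := []
  logStart := 0
  logEnd := 0
  pending := 0

/-- The number of size classes, `⌊lg Δ⌋ + 1` for `Δ ≥ 1`. -/
def State.numClasses (s : State) : ℕ := sizeClass s.maxLen

/-- The first cell of the region of class `i`. -/
def State.regionStart (s : State) (i : ℕ) : ℕ :=
  ∑ j ∈ Finset.range i, ((s.region j).payCap + (s.region j).bufCap)

/-- The first cell of the buffer segment of class `i`. -/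
def State.bufStart (s : State) (i : ℕ) : ℕ := s.regionStart i + (s.region i).payCap

/-- The first cell of the tail buffer. -/
def State.tailStart (s : State) : ℕ := s.regionStart (s.numClasses + 1)

/-- The end of the last segment. -/
def State.layoutEnd (s : State) : ℕ := s.tailStart + s.tailCap

/-- The items in the regions and in the tail buffer. -/
def State.mainItems (s : State) : List Item :=
  (List.range (s.numClasses + 1)).flatMap
    (fun i => (s.region i).payload ++ (s.region i).buffer) ++ s.tail

/-- The total space used: everything up to the end of the last segment, of the last stored item
and, while a flush is in progress, of its temporary working space and log. -/
def State.space (s : State) : ℕ :=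
  max s.layoutEnd
    (max (lastCell (s.mainItems ++ s.overflow ++ s.log))
      (match s.phase with
        | .idle => 0
        | _ => s.logEnd))

/-- Change every item in the regions, the tail buffer and the overflow list by `f`. -/
def State.mapItems (f : Item → Item) (s : State) : State :=
  { s with
    region := fun i =>
      { s.region i with
        payload := (s.region i).payload.map f
        buffer := (s.region i).buffer.map f }
    tail := s.tail.map f
    overflow := s.overflow.map f }

/-- Carry out a move. -/
def State.relocate (s : State) (m : Move) : State :=
  s.mapItems (fun x => if x.name = m.name ∧ x.kind = .live then { x with addr := m.target } else x)

/-- The object `n` becomes a hole. -/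
def State.markDead (s : State) (n : ℕ) : State :=
  s.mapItems (fun x => if x.name = n ∧ x.kind = .live then { x with kind := .dead } else x)

/-! ### Storing an item in a buffer -/

/-- The earliest buffer of a class `j ≥ sizeClass w` with `w` unoccupied cells. -/
def State.findBuffer (s : State) (w : ℕ) : Option ℕ :=
  (List.range (s.numClasses + 1)).find?
    (fun j => sizeClass w ≤ j ∧ vol (s.region j).buffer + w ≤ (s.region j).bufCap)

/-- Append an item to the buffer of class `j`. -/
def State.pushBuffer (s : State) (j : ℕ) (x : Item) : State :=
  { s with
    region := Function.update s.region j
      { s.region j with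
        buffer := (s.region j).buffer ++
          [{ x with addr := s.bufStart j + vol (s.region j).buffer }] } }

/-- Append an item to the tail buffer. -/
def State.pushTail (s : State) (x : Item) : State :=
  { s with tail := s.tail ++ [{ x with addr := s.tailStart + vol s.tail }] }

/-- Store an item at the end of the earliest buffer that can take it, the tail buffer being the
last one; `none` if there is no such buffer. -/
def State.tryStore (s : State) (x : Item) : Option State :=
  match s.findBuffer x.size with
  | some j => some (s.pushBuffer j x)
  | none => if vol s.tail + x.size ≤ s.tailCap then some (s.pushTail x) else none

/-! ### Planning a flush -/

/-- The class `b` is admissible as the boundary class: everything in the tail buffer and in the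
buffers of classes `≥ b` belongs to classes `≥ b`. -/
def State.Admissible (s : State) (b : ℕ) : Prop :=
  (∀ x ∈ s.tail, b ≤ sizeClass x.size) ∧
    ∀ j ∈ List.range (s.numClasses + 1), b ≤ j →
      ∀ x ∈ (s.region j).buffer, b ≤ sizeClass x.size

instance (s : State) : DecidablePred s.Admissible := fun b => by
  unfold State.Admissible; infer_instance

/-- The boundary class of a flush triggered by the insertion or deletion of an object of length
`w`: the largest admissible class that is at most the class of this object. -/
def State.boundary (s : State) (w : ℕ) : ℕ := Nat.findGreatest s.Admissible (sizeClass w)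

/-- The classes `b, b + 1, …` up to the last one. -/
def State.classesFrom (s : State) (b : ℕ) : List ℕ := List.range' b (s.numClasses + 1 - b)

/-- The volume `V(i)` of the live objects of class `i`. -/
def State.classVol (s : State) (i : ℕ) : ℕ := vol (ofClass i (live s.mainItems))

/-- The volume `V_f` of all live objects. -/
def State.totalVol (s : State) : ℕ := vol (live s.mainItems)

/-- The length of a buffer for a volume `v`. -/
noncomputable def bufLen (ε : ℝ) (v : ℕ) : ℕ := ⌊ε * v⌋₊

/-- The first cell of the region of class `i ≥ b` after a flush with boundary class `b`. -/
noncomputable def State.newStart (ε : ℝ) (s : State) (b i : ℕ) : ℕ :=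
  s.regionStart b + ∑ j ∈ Finset.Ico b i, (s.classVol j + bufLen ε (s.classVol j))

/-- The end of the last segment after a flush with boundary class `b`. -/
noncomputable def State.newEnd (ε : ℝ) (s : State) (b : ℕ) : ℕ :=
  s.newStart ε b (s.numClasses + 1) + bufLen ε s.totalVol

/-- The total length `B` of the buffers that take part in the flush. -/
def State.flushedBufs (s : State) (b : ℕ) : ℕ :=
  ((s.classesFrom b).map (fun i => (s.region i).bufCap)).sum + s.tailCap

/-- The live objects in the buffers that take part in the flush. -/
def State.buffered (s : State) (b : ℕ) : List Item :=
  (s.classesFrom b).flatMap (fun i => live (s.region i).buffer) ++ live s.tail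

/-- The moves that put the objects of a list next to each other, from address `a` on. -/
def layFrom : ℕ → List Item → List Move
  | _, [] => []
  | a, x :: xs => ⟨x.name, x.size, a⟩ :: layFrom (a + x.size) xs

/-- The address `max {L, L'} + B + Δ`, where `L` is the end of the contents of the array and `L'`
the end of the last segment after the flush, both reduced by the length `ins` of the inserted
object if the flush is triggered by an insertion (`ins = 0` otherwise). -/
noncomputable def State.pivot (ε : ℝ) (s : State) (b ins : ℕ) : ℕ :=
  max (s.tailStart + vol s.tail - ins) (s.newEnd ε b - ins) + s.flushedBufs b + s.maxLen

/-- The moves of a flush: the buffered objects go to the cells from the pivot `T` on; the payload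
objects are packed to the left of `T`, last object first; the payload objects go to their final
places, first object first; the buffered objects go to the ends of their payload segments. -/
noncomputable def State.flushMoves (ε : ℝ) (s : State) (b ins : ℕ) : List Move :=
  let T := s.pivot ε b ins
  let pay := (s.classesFrom b).flatMap (fun i => live (s.region i).payload)
  layFrom T (s.buffered b) ++
  (layFrom (T - vol pay) pay).reverse ++
  (s.classesFrom b).flatMap (fun i =>
    layFrom (s.newStart ε b i) (live (s.region i).payload)) ++
  (s.classesFrom b).flatMap (fun i =>
    layFrom (s.newStart ε b i + vol (live (s.region i).payload)) (ofClass i (s.buffered b)))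

/-- Start a flush that is triggered by the insertion (`isInsert = true`) or deletion of an object
of length `w`.  Holes and delete records in the flushed segments are dropped, and the log begins
right behind the temporary working space. -/
noncomputable def State.startFlush (ε : ℝ) (s : State) (w : ℕ) (isInsert : Bool) : State :=
  let b := s.boundary w
  let ins := if isInsert then w else 0
  let logStart := s.pivot ε b ins + vol (s.buffered b)
  { s with
    region := fun i =>
      if b ≤ i then
        { s.region i with payload := live (s.region i).payload, buffer := [] }
      else s.region i
    tail := []
    phase := .moving ⟨b, s.classVol, s.totalVol, s.flushMoves ε b ins⟩
    overflow := s.buffered b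
    logStart := logStart
    logEnd := logStart
    pending := if isInsert then 0 else w }

/-- The new segment boundaries take effect when all moves of the plan are done. -/
noncomputable def State.install (ε : ℝ) (s : State) (p : Plan) : State :=
  { s with
    region := fun i =>
      if p.boundary ≤ i then
        { payCap := p.classVol i
          bufCap := bufLen ε (p.classVol i)
          payload := (s.region i).payload ++ ofClass i s.overflow
          buffer := [] }
      else s.region i
    tailCap := bufLen ε p.totalVol
    tail := []
    overflow := []
    phase := .draining }

/-- The flush terminates when the log is completely processed; the log disappears. -/
def State.finish (s : State) : State :=
  match s.phase, s.log with
  | .draining, [] => { s with phase := .idle, logStart := 0, logEnd := 0, pending := 0 }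
  | _, _ => s

/-- The transitions of a flush that move no object. -/
noncomputable def State.settle (ε : ℝ) (s : State) : State :=
  match s.phase with
  | .moving p => if p.moves.isEmpty then (s.install ε p).finish else s
  | _ => s.finish

/-! ### Carrying out insertions and deletions -/

/-- Insert the object `n` of length `w` into the buffers.  If it does not fit, it is placed at the
end of the tail buffer, beyond its capacity, and a flush is triggered. -/
noncomputable def State.performInsert (ε : ℝ) (s : State) (n w : ℕ) : State :=
  match s.tryStore ⟨n, w, 0, .live⟩ with
  | some s' => s'
  | none => (s.pushTail ⟨n, w, 0, .live⟩).startFlush ε w true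

/-- Delete the object `n` of length `w`: it leaves a hole, and a delete record of length `w` is put
into the buffers.  If this record does not fit, it is not stored and a flush is triggered. -/
noncomputable def State.performDelete (ε : ℝ) (s : State) (n w : ℕ) : State :=
  match (s.markDead n).tryStore ⟨n, w, 0, .record⟩ with
  | some s' => s'
  | none => (s.markDead n).startFlush ε w false

/-- One step of the flush in progress, together with its volume: carry out the next move, or
re-insert / re-delete the first item of the log. -/
noncomputable def State.step (ε : ℝ) (s : State) : State × ℕ :=
  match s.phase, s.log with
  | .moving ⟨b, cv, tv, m :: ms⟩, _ =>
      ((({ s with phase := .moving ⟨b, cv, tv, ms⟩ } : State).relocate m).settle ε, m.size)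
  | .draining, x :: xs =>
      let s' : State := { s with log := xs }
      ((if x.kind = .live then s'.performInsert ε x.name x.size
        else s'.performDelete ε x.name x.size).settle ε, x.size)
  | _, _ => (s, 0)

/-- Passing from `s` to `s'`, the end of a flush has triggered the next one. -/
def triggered (s s' : State) : Bool :=
  match s.phase, s'.phase with
  | .draining, .moving _ => true
  | _, _ => false

/-- Perform steps of the flush in progress until their volume is at least `k` or no flush is in
progress.  If a new flush is triggered meanwhile, it is worked on with what is left of `k` if
`eager` holds, and not yet otherwise. -/
noncomputable def State.work (ε : ℝ) (eager : Bool) : ℕ → State → State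
  | 0, s => s
  | k + 1, s =>
    match s.phase with
    | .idle => s
    | _ =>
      let r := s.step ε
      if triggered s r.1 && !eager then r.1
      else State.work ε eager (k - (r.2 - 1)) r.1
termination_by k => k

/-- The least integral volume exceeding `(4/ε) w`. -/
noncomputable def workVolume (ε : ℝ) (w : ℕ) : ℕ := ⌊4 / ε * w⌋₊ + 1

/-- Append an item to the log. -/
def State.pushLog (s : State) (x : Item) : State :=
  { s with log := s.log ++ [{ x with addr := s.logEnd }], logEnd := s.logEnd + x.size }

/-- The length of the object that a request inserts or deletes. -/
def State.requestLength (s : State) : Request → ℕ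
  | .insert _ w => w
  | .delete n => s.active.lengthOf n

/-- Process a request.  If no flush is in progress, it is carried out at once; otherwise it is
placed at the end of the log.  On a request of length `w` that finds a flush in progress, just over
`(4/ε) w` steps by volume of the flush are performed.  The Boolean `eager` tells whether a request
that triggers a flush also spends its share of work on this flush (`true`), or whether only the
subsequent requests do (`false`). -/
noncomputable def State.process (ε : ℝ) (eager : Bool) (s : State) (r : Request) : State :=
  let w := s.requestLength r
  let s₀ : State := { s with active := s.active.update r, maxLen := r.maxLength s.maxLen }
  match s.phase with
  | .idle =>
      let s₁ := (match r with
        | .insert n _ => s₀.performInsert ε n w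
        | .delete n => s₀.performDelete ε n w).settle ε
      if eager then s₁.work ε eager (workVolume ε w) else s₁
  | _ =>
      (match r with
        | .insert n _ => s₀.pushLog ⟨n, w, 0, .live⟩
        | .delete n => s₀.pushLog ⟨n, w, 0, .record⟩).work ε eager (workVolume ε w)

/-- The state of the deamortized data structure after a sequence of requests. -/
noncomputable def run (ε : ℝ) (eager : Bool) (rs : List Request) : State :=
  rs.foldl (State.process ε eager) State.init

/-- The volume that counts as active.  If a request that triggers a flush does no work on it, then
the object whose deletion has triggered the flush in progress counts as active until the flush
completes. -/
noncomputable def countedVolume (ε : ℝ) (eager : Bool) (rs : List Request) : ℕ :=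
  if eager then activeVolume rs else activeVolume rs + (run ε eager rs).pending

end StorageRealloc

namespace StorageRealloc

/-! ### Volumes of lists of items and of multisets of objects -/

/-! The proof is an amortized account attached to an invariant `PhaseInv`, which says what the array
looks like in each phase and how much work is still due.

Between flushes, segment lengths are paid for (`Budget`): the payload segment of class i is at most
as long as the live objects of class i together with the items of class i lying in buffers, and the
tail buffer is at most ε times the corresponding total. Storing an item preserves this: a deletion
takes w from the live volume, but its record adds w to a buffer; an insertion only adds. Since
buffers are at most ε times their payload segments and cannot hold more than their length, the
inequalities close up (`layout_bound`): the layout has length at most (1 + 8ε)V and all buffers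
together at most 4εV. This is the idle bound.

At the start of a flush the old layout and the goal layout both satisfy such a bound. The working
space adds the flushed buffers twice, once in T and once for the objects moved behind T, and Δ once.
An inserted object that triggers the flush overfills the tail buffer by w; subtracting w in L and L'
absorbs this, so that no second Δ appears. Hence the log starts by (1 + 16ε)X + Δ, where X is the
volume V_f of the flush plus the length of the object whose deletion triggered it, if any
(`Shape.logStart_le`). Nothing about intermediate positions is needed beyond their lying in front of
the log: `Moving` predicts the address at which each object will land, and this prediction does not
change as moves are executed.

The log stays short because of the work account (`Ledger`). A flush costs at most 2V_f for its moves
plus the log volume W, whereas logged requests of total length W pay (4/ε)W; so W ≤ εV_f once no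
work is due. Before the latest request, the log therefore fitted into the new tail buffer, whose
length is ⌊εV_f⌋. So while the log is drained only its last item can fail to fit, and a new flush
begins with an empty log (`step_draining`). Also V_f ≤ V + W, so V_f is V up to a factor 1 + O(ε).

It remains to treat a deletion that triggers a flush, whose object no longer counts in V. In the
lazy variant its length is counted by definition. In the eager variant, the request that works on
the new flush either has spent enough work on it or would have completed it; in the account this
makes the deleted length O(εV) (`trigger_bound`, `Ledger.logEnd_le`). -/

/-- The live objects of a list of items, as pairs (name, length). -/
def key (l : List Item) : Multiset (ℕ × ℕ) := ↑((live l).map fun x => (x.name, x.size))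

/-- The total length of a multiset of objects. -/
def dvol (M : Multiset (ℕ × ℕ)) : ℕ := (M.map Prod.snd).sum

/-- The total length of the objects of class `i` in a multiset. -/
def cvol (i : ℕ) (M : Multiset (ℕ × ℕ)) : ℕ := dvol (M.filter fun p => sizeClass p.2 = i)

@[simp] lemma vol_nil : vol [] = 0 := rfl

@[simp] lemma vol_cons (x : Item) (l : List Item) : vol (x :: l) = x.size + vol l := by
  simp [vol]

@[simp] lemma vol_append (l l' : List Item) : vol (l ++ l') = vol l + vol l' := by
  simp [vol]

@[simp] lemma live_nil : live [] = [] := rfl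

@[simp] lemma live_append (l l' : List Item) : live (l ++ l') = live l ++ live l' := by
  simp [live]

lemma mem_live {x : Item} {l : List Item} : x ∈ live l ↔ x ∈ l ∧ x.kind = .live := by
  simp [live]

@[simp] lemma live_live (l : List Item) : live (live l) = live l := by
  simp [live]

@[simp] lemma ofClass_nil (i : ℕ) : ofClass i [] = [] := rfl

@[simp] lemma ofClass_append (i : ℕ) (l l' : List Item) :
    ofClass i (l ++ l') = ofClass i l ++ ofClass i l' := by
  simp [ofClass]

lemma mem_ofClass {i : ℕ} {x : Item} {l : List Item} :
    x ∈ ofClass i l ↔ x ∈ l ∧ sizeClass x.size = i := by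
  simp [ofClass]

lemma ofClass_cons (i : ℕ) (x : Item) (l : List Item) :
    ofClass i (x :: l) = if sizeClass x.size = i then x :: ofClass i l else ofClass i l := by
  by_cases h : sizeClass x.size = i <;> simp [ofClass, h]

lemma vol_ofClass_eq_zero {i : ℕ} {l : List Item} (h : ∀ x ∈ l, sizeClass x.size ≠ i) :
    vol (ofClass i l) = 0 := by
  have : ofClass i l = [] := by simpa [ofClass, List.filter_eq_nil_iff] using h
  simp [this]

lemma ofClass_eq_self {i : ℕ} {l : List Item} (h : ∀ x ∈ l, sizeClass x.size = i) :
    ofClass i l = l := by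
  simpa [ofClass, List.filter_eq_self] using h

lemma live_eq_self {l : List Item} (h : ∀ x ∈ l, x.kind = .live) : live l = l := by
  simpa [live, List.filter_eq_self] using h

lemma vol_live_le (l : List Item) : vol (live l) ≤ vol l := by
  induction l with
  | nil => simp
  | cons x l ih =>
    by_cases h : x.kind = .live <;> simp_all [live]
    omega

lemma sum_vol_ofClass_le (t : Finset ℕ) (l : List Item) :
    ∑ i ∈ t, vol (ofClass i l) ≤ vol l := by
  induction l with
  | nil => simp
  | cons x l ih =>
    have : ∀ i, vol (ofClass i (x :: l)) =
        (if sizeClass x.size = i then x.size else 0) + vol (ofClass i l) := by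
      intro i; rw [ofClass_cons]; split <;> simp
    simp only [this, Finset.sum_add_distrib, Finset.sum_ite_eq, vol_cons]
    split <;> omega

@[simp] lemma key_nil : key [] = 0 := rfl

@[simp] lemma key_append (l l' : List Item) : key (l ++ l') = key l + key l' := by
  simp [key, ← Multiset.coe_add]

@[simp] lemma key_live (l : List Item) : key (live l) = key l := by simp [key]

lemma key_cons (x : Item) (l : List Item) : key (x :: l) = key [x] + key l :=
  key_append [x] l

lemma key_singleton (x : Item) :
    key [x] = if x.kind = .live then {(x.name, x.size)} else 0 := by
  by_cases h : x.kind = .live <;> simp [key, live, h]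

lemma mem_key {x : Item} {l : List Item} (h : x ∈ l) (hk : x.kind = .live) :
    (x.name, x.size) ∈ key l := by
  simp only [key, Multiset.mem_coe, List.mem_map]
  exact ⟨x, mem_live.2 ⟨h, hk⟩, rfl⟩

@[simp] lemma dvol_zero : dvol 0 = 0 := rfl

@[simp] lemma dvol_add (M N : Multiset (ℕ × ℕ)) : dvol (M + N) = dvol M + dvol N := by
  simp [dvol]

@[simp] lemma dvol_cons (p : ℕ × ℕ) (M : Multiset (ℕ × ℕ)) : dvol (p ::ₘ M) = p.2 + dvol M := by
  simp [dvol]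

@[simp] lemma cvol_zero (i : ℕ) : cvol i 0 = 0 := rfl

@[simp] lemma cvol_add (i : ℕ) (M N : Multiset (ℕ × ℕ)) :
    cvol i (M + N) = cvol i M + cvol i N := by
  simp [cvol]

lemma cvol_cons (i : ℕ) (p : ℕ × ℕ) (M : Multiset (ℕ × ℕ)) :
    cvol i (p ::ₘ M) = (if sizeClass p.2 = i then p.2 else 0) + cvol i M := by
  by_cases h : sizeClass p.2 = i <;> simp [cvol, h]

lemma dvol_sum {ι : Type*} (t : Finset ι) (f : ι → Multiset (ℕ × ℕ)) :
    dvol (∑ j ∈ t, f j) = ∑ j ∈ t, dvol (f j) := by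
  classical
  induction t using Finset.induction_on with
  | empty => simp
  | insert a t ha ih => simp [Finset.sum_insert ha, ih]

lemma cvol_sum {ι : Type*} (i : ℕ) (t : Finset ι) (f : ι → Multiset (ℕ × ℕ)) :
    cvol i (∑ j ∈ t, f j) = ∑ j ∈ t, cvol i (f j) := by
  classical
  induction t using Finset.induction_on with
  | empty => simp
  | insert a t ha ih => simp [Finset.sum_insert ha, ih]

lemma sum_cvol_le (t : Finset ℕ) (M : Multiset (ℕ × ℕ)) : ∑ i ∈ t, cvol i M ≤ dvol M := by
  induction M using Multiset.induction_on with
  | empty => simp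
  | cons p M ih =>
    simp only [cvol_cons, Finset.sum_add_distrib, Finset.sum_ite_eq, dvol_cons]
    split <;> omega

lemma cvol_eq_zero {i : ℕ} {M : Multiset (ℕ × ℕ)} (h : ∀ p ∈ M, sizeClass p.2 ≠ i) :
    cvol i M = 0 := by
  have : M.filter (fun p => sizeClass p.2 = i) = 0 := by
    simpa [Multiset.filter_eq_nil] using h
  simp [cvol, this]

lemma vol_live_eq (l : List Item) : vol (live l) = dvol (key l) := by
  simp [vol, dvol, key, Function.comp_def]

lemma vol_ofClass_live_eq (i : ℕ) (l : List Item) :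
    vol (ofClass i (live l)) = cvol i (key l) := by
  simp only [vol, cvol, dvol, key, ofClass, Multiset.filter_coe, Multiset.map_coe,
    Multiset.sum_coe, List.filter_map, List.map_map]
  rfl

lemma key_flatMap (l : List ℕ) (f : ℕ → List Item) :
    key (l.flatMap f) = (l.map fun i => key (f i)).sum := by
  induction l with
  | nil => simp
  | cons a l ih => simp [ih]

lemma vol_flatMap (l : List ℕ) (f : ℕ → List Item) :
    vol (l.flatMap f) = (l.map fun i => vol (f i)).sum := by
  induction l with
  | nil => simp
  | cons a l ih => simp [ih]

lemma sum_map_range' {α : Type*} [AddCommMonoid α] (b n : ℕ) (f : ℕ → α) :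
    ((List.range' b (n + 1 - b)).map f).sum = ∑ i ∈ Finset.Ico b (n + 1), f i := rfl

lemma sum_map_range {α : Type*} [AddCommMonoid α] (n : ℕ) (f : ℕ → α) :
    ((List.range n).map f).sum = ∑ i ∈ Finset.range n, f i := rfl

lemma key_map {f : Item → Item} (l : List Item)
    (hf : ∀ x, (f x).name = x.name ∧ (f x).size = x.size ∧ (f x).kind = x.kind) :
    key (l.map f) = key l := by
  induction l with
  | nil => rfl
  | cons x l ih =>
    rw [List.map_cons, key_cons, ih, key_cons x, key_singleton, key_singleton, (hf x).1,
      (hf x).2.1, (hf x).2.2]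

lemma vol_map {f : Item → Item} (l : List Item) (hf : ∀ x, (f x).size = x.size) :
    vol (l.map f) = vol l := by
  simp [vol, Function.comp_def, hf]

lemma vol_ofClass_map {f : Item → Item} (i : ℕ) (l : List Item)
    (hf : ∀ x, (f x).size = x.size) :
    vol (ofClass i (l.map f)) = vol (ofClass i l) := by
  simp [vol, ofClass, List.filter_map, Function.comp_def, hf]

lemma sizeClass_mono {v w : ℕ} (h : v ≤ w) : sizeClass v ≤ sizeClass w := Nat.size_le_size h

lemma lastCell_le {l : List Item} {a : ℕ} (h : ∀ x ∈ l, x.addr + x.size ≤ a) :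
    lastCell l ≤ a := by
  induction l with
  | nil => simp [lastCell]
  | cons x l ih =>
    simp only [lastCell, List.map_cons, List.foldr_cons, max_le_iff]
    exact ⟨h x (by simp), ih fun y hy => h y (by simp [hy])⟩

/-! ### Objects with distinct names -/

lemma eq_snd_of_nodup {M : Multiset (ℕ × ℕ)} (h : (M.map Prod.fst).Nodup) {n v w : ℕ}
    (hv : (n, v) ∈ M) (hw : (n, w) ∈ M) : v = w := by
  have := Multiset.inj_on_of_nodup_map h _ hv _ hw rfl
  exact (Prod.mk.inj this).2

/-- Since names are distinct, deleting by name removes exactly one object; this gives the volume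
lost by a deletion. -/
lemma filter_of_mem {M : Multiset (ℕ × ℕ)} (h : (M.map Prod.fst).Nodup) {n w : ℕ}
    (hw : (n, w) ∈ M) : (n, w) ::ₘ M.filter (fun p => p.1 ≠ n) = M := by
  obtain ⟨N, rfl⟩ := Multiset.exists_cons_of_mem hw
  simp only [Multiset.map_cons, Multiset.nodup_cons] at h
  rw [Multiset.filter_cons_of_neg _ (by simp)]
  congr 1
  rw [Multiset.filter_eq_self]
  rintro p hp rfl
  exact h.1 (Multiset.mem_map_of_mem _ hp)

/-! ### Sequences of moves -/

/-- The total volume of a list of moves. -/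
def moveVol (ms : List Move) : ℕ := (ms.map Move.size).sum

@[simp] lemma moveVol_nil : moveVol [] = 0 := rfl

@[simp] lemma moveVol_cons (m : Move) (ms : List Move) :
    moveVol (m :: ms) = m.size + moveVol ms := by simp [moveVol]

@[simp] lemma moveVol_append (l l' : List Move) : moveVol (l ++ l') = moveVol l + moveVol l' := by
  simp [moveVol]

@[simp] lemma moveVol_reverse (l : List Move) : moveVol l.reverse = moveVol l := by
  simp [moveVol]

lemma moveVol_flatMap (l : List ℕ) (f : ℕ → List Move) :
    moveVol (l.flatMap f) = (l.map fun i => moveVol (f i)).sum := by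
  induction l with
  | nil => simp
  | cons a l ih => simp [ih]

@[simp] lemma moveVol_layFrom (a : ℕ) (l : List Item) : moveVol (layFrom a l) = vol l := by
  induction l generalizing a with
  | nil => rfl
  | cons x l ih => simp [layFrom, ih]

lemma of_mem_layFrom {a : ℕ} {l : List Item} {m : Move} (h : m ∈ layFrom a l) :
    ∃ y ∈ l, m.name = y.name ∧ m.size = y.size ∧ m.target + m.size ≤ a + vol l := by
  induction l generalizing a with
  | nil => simp [layFrom] at h
  | cons x l ih =>
    simp only [layFrom, List.mem_cons] at h
    rcases h with rfl | h
    · exact ⟨x, by simp, rfl, rfl, by simp⟩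
    · obtain ⟨y, hy, h1, h2, h3⟩ := ih h
      exact ⟨y, by simp [hy], h1, h2, by simp; omega⟩

lemma exists_mem_layFrom (a : ℕ) {l : List Item} {y : Item} (h : y ∈ l) :
    ∃ m ∈ layFrom a l, m.name = y.name := by
  induction l generalizing a with
  | nil => simp at h
  | cons x l ih =>
    rcases List.mem_cons.1 h with rfl | h
    · exact ⟨⟨y.name, y.size, a⟩, by simp [layFrom], rfl⟩
    · obtain ⟨m, hm, h1⟩ := ih (a + x.size) h
      exact ⟨m, by simp [layFrom, hm], h1⟩

/-- The address of an object after a sequence of moves. -/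
def landing (ms : List Move) (n a : ℕ) : ℕ :=
  ms.foldl (fun a m => if m.name = n then m.target else a) a

lemma landing_append (l l' : List Move) (n a : ℕ) :
    landing (l ++ l') n a = landing l' n (landing l n a) := by
  simp [landing]

lemma landing_mem (ms : List Move) (n a : ℕ) :
    landing ms n a = a ∧ (∀ m ∈ ms, m.name ≠ n) ∨
      ∃ m ∈ ms, m.name = n ∧ landing ms n a = m.target := by
  induction ms generalizing a with
  | nil => simp [landing]
  | cons m ms ih =>
    by_cases hm : m.name = n
    · right
      rcases ih m.target with h | ⟨m', h1, h2, h3⟩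
      · exact ⟨m, by simp, hm, by simpa [landing, hm] using h.1⟩
      · exact ⟨m', by simp [h1], h2, by simpa [landing, hm] using h3⟩
    · rcases ih a with h | ⟨m', h1, h2, h3⟩
      · left
        refine ⟨by simpa [landing, hm] using h.1, ?_⟩
        simpa [hm] using h.2
      · exact .inr ⟨m', by simp [h1], h2, by simpa [landing, hm] using h3⟩

/-- A later move overrides earlier ones, so once `l'` moves the object, the detour through `l` is
irrelevant. -/
lemma landing_append_le {l l' : List Move} {n a v e : ℕ} (hex : ∃ m ∈ l', m.name = n)
    (h : ∀ m ∈ l', m.name = n → m.target + v ≤ e) : landing (l ++ l') n a + v ≤ e := by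
  rw [landing_append]
  rcases landing_mem l' n (landing l n a) with h' | ⟨m, h1, h2, h3⟩
  · obtain ⟨m, hm, hn⟩ := hex
    exact absurd hn (h'.2 m hm)
  · rw [h3]; exact h m h1 h2

/-! ### The layout between flushes -/

/-- The first cell of the region of class `i`. -/
def regStart (reg : ℕ → Region) (i : ℕ) : ℕ :=
  ∑ j ∈ Finset.range i, ((reg j).payCap + (reg j).bufCap)

lemma regStart_mono (reg : ℕ → Region) {i j : ℕ} (h : i ≤ j) :
    regStart reg i ≤ regStart reg j :=
  Finset.sum_le_sum_of_subset (by simpa using h)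

lemma regStart_succ (reg : ℕ → Region) (i : ℕ) :
    regStart reg (i + 1) = regStart reg i + ((reg i).payCap + (reg i).bufCap) :=
  Finset.sum_range_succ _ _

lemma regStart_congr {reg reg' : ℕ → Region} {i : ℕ}
    (h : ∀ j < i, (reg j).payCap = (reg' j).payCap ∧ (reg j).bufCap = (reg' j).bufCap) :
    regStart reg i = regStart reg' i :=
  Finset.sum_congr rfl fun j hj => by
    rw [(h j (Finset.mem_range.1 hj)).1, (h j (Finset.mem_range.1 hj)).2]

lemma sum_range_extend {α : Type*} [AddCommMonoid α] {m n : ℕ} (h : m ≤ n) {f : ℕ → α}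
    (hf : ∀ i, m < i → f i = 0) :
    ∑ i ∈ Finset.range (m + 1), f i = ∑ i ∈ Finset.range (n + 1), f i := by
  refine Finset.sum_subset (by simpa using h) fun i _ hi => hf i ?_
  simp at hi; omega

/-- The live objects in the regions `0, …, n` and in the tail buffer. -/
def content (reg : ℕ → Region) (n : ℕ) (tl : List Item) : Multiset (ℕ × ℕ) :=
  ∑ i ∈ Finset.range (n + 1), (key (reg i).payload + key (reg i).buffer) + key tl

lemma key_mainItems (s : State) :
    key s.mainItems = content s.region (sizeClass s.maxLen) s.tail := by
  simp only [State.mainItems, key_append, key_flatMap, content, sum_map_range]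
  rfl

lemma mem_mainItems {s : State} {x : Item} : x ∈ s.mainItems ↔
    (∃ i ≤ sizeClass s.maxLen, x ∈ (s.region i).payload ∨ x ∈ (s.region i).buffer) ∨
      x ∈ s.tail := by
  simp [State.mainItems, State.numClasses]

/-- The segments and their contents are as they should be, the tail buffer being overfull by at
most `ex`, and the live objects are those of `D`. -/
structure Shape (ε : ℝ) (ex : ℕ) (reg : ℕ → Region) (tc : ℕ) (tl : List Item) (Δ : ℕ)
    (D : Multiset (ℕ × ℕ)) : Prop where
  nodup : (D.map Prod.fst).Nodup
  size_mem : ∀ p ∈ D, 1 ≤ p.2 ∧ p.2 ≤ Δ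
  content_eq : content reg (sizeClass Δ) tl = D
  beyond : ∀ i, sizeClass Δ < i → reg i = ⟨0, 0, [], []⟩
  payload_class : ∀ i, ∀ x ∈ (reg i).payload, sizeClass x.size = i
  buffer_class : ∀ i, ∀ x ∈ (reg i).buffer, sizeClass x.size ≤ i
  payload_end : ∀ i, ∀ x ∈ (reg i).payload, x.addr + x.size ≤ regStart reg (i + 1)
  buffer_end : ∀ i, ∀ x ∈ (reg i).buffer, x.addr + x.size ≤ regStart reg (i + 1)
  tail_end : ∀ x ∈ tl, x.addr + x.size ≤ regStart reg (sizeClass Δ + 1) + tc + ex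
  bufCap_le : ∀ i, ((reg i).bufCap : ℝ) ≤ ε * (reg i).payCap
  buffer_vol : ∀ i, vol (reg i).buffer ≤ (reg i).bufCap
  tail_vol : vol tl ≤ tc + ex

/-- The lengths of the segments are paid for by the objects of `M` and the items in the buffers. -/
structure Budget (ε : ℝ) (reg : ℕ → Region) (tc : ℕ) (tl : List Item) (Δ : ℕ)
    (M : Multiset (ℕ × ℕ)) : Prop where
  payCap_le : ∀ i, (reg i).payCap ≤ cvol i M +
    ∑ j ∈ Finset.range (sizeClass Δ + 1), vol (ofClass i (reg j).buffer) + vol (ofClass i tl)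
  tailCap_le : (tc : ℝ) ≤ ε * (dvol M +
    ∑ j ∈ Finset.range (sizeClass Δ + 1), vol (reg j).buffer + vol tl : ℕ)

/-- The consequences of the budget for the total lengths `P` of the payload segments, `B` of the
buffers and `t` of the tail buffer. -/
lemma layout_bound {ε P B β t τ V : ℝ} (hε : 0 < ε) (hε' : ε ≤ 1 / 4) (hV : 0 ≤ V)
    (hP0 : 0 ≤ P) (hB : B ≤ ε * P) (hβ : β ≤ B) (hτ : τ ≤ t) (hP : P ≤ V + β + τ)
    (ht : t ≤ ε * (V + β + τ)) :
    P + B + t ≤ (1 + 8 * ε) * V ∧ B + t ≤ 4 * ε * V := by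
  -- Eliminating β and τ leaves two inequalities in P and t alone. The second is solved for t with 1
  -- - ε ≥ 3/4, and ε²P is replaced by εP/4.
  have h1 : P ≤ V + ε * P + t := by linarith
  have h2 : t ≤ ε * (V + ε * P + t) := ht.trans (by gcongr; linarith)
  have h3 : 0 ≤ (1 / 4 - ε) * P := mul_nonneg (by linarith) hP0
  have h4 : 0 ≤ ε * V := by positivity
  have ht0 : t * (1 - ε) ≤ ε * V + ε * (ε * P) := by linarith
  have hεP : ε * (ε * P) ≤ ε * P / 4 := by nlinarith [mul_nonneg hε.le h3]
  have ht1 : t ≤ 4 / 3 * (ε * V + ε * (ε * P)) := by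
    by_cases h : 0 ≤ t
    · nlinarith
    · have : 0 ≤ ε * (ε * P) := by positivity
      linarith
  have h5 : P * (1 - 4 / 3 * ε) ≤ V * (1 + 4 / 3 * ε) := by
    have : 0 ≤ ε * P := by positivity
    nlinarith
  have h6 : P ≤ (1 + 4 * ε) * V := by
    -- For V > 0 this is equivalent to ε ≤ 1/4, so the constant 4 is matched to the range of ε.
    have h7 : V * (1 + 4 / 3 * ε) ≤ (1 + 4 * ε) * V * (1 - 4 / 3 * ε) := by
      have : 0 ≤ ε * V * (1 / 4 - ε) := mul_nonneg h4 (by linarith)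
      nlinarith
    exact le_of_mul_le_mul_right (h5.trans h7) (by linarith)
  have h8 : ε * P ≤ 2 * (ε * V) := by
    have : ε * P ≤ ε * ((1 + 4 * ε) * V) := by gcongr
    nlinarith
  constructor <;> nlinarith

lemma Budget.mono {ε : ℝ} {reg tc tl Δ} {M N : Multiset (ℕ × ℕ)} (hε : 0 < ε)
    (h : Budget ε reg tc tl Δ M) : Budget ε reg tc tl Δ (N + M) where
  payCap_le i := (h.payCap_le i).trans (by simp)
  tailCap_le := h.tailCap_le.trans (by gcongr; simp)

/-- Each object and each buffered item belongs to one class only, so summing over the classes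
charges it at most once. -/
lemma Budget.sum_payCap_le {ε : ℝ} {reg tc tl Δ} {M : Multiset (ℕ × ℕ)}
    (h : Budget ε reg tc tl Δ M) :
    ∑ i ∈ Finset.range (sizeClass Δ + 1), (reg i).payCap ≤
      dvol M + ∑ j ∈ Finset.range (sizeClass Δ + 1), vol (reg j).buffer + vol tl := by
  refine (Finset.sum_le_sum fun i _ => h.payCap_le i).trans ?_
  rw [Finset.sum_add_distrib, Finset.sum_add_distrib, Finset.sum_comm]
  gcongr
  · exact sum_cvol_le _ _
  · exact sum_vol_ofClass_le _ _
  · exact sum_vol_ofClass_le _ _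

lemma regStart_eq (reg : ℕ → Region) (i : ℕ) : regStart reg i =
    ∑ j ∈ Finset.range i, (reg j).payCap + ∑ j ∈ Finset.range i, (reg j).bufCap :=
  Finset.sum_add_distrib

lemma Budget.layout_le {ε : ℝ} {reg tc tl Δ} {M : Multiset (ℕ × ℕ)} (hε : 0 < ε)
    (hε' : ε ≤ 1 / 4) (h : Budget ε reg tc tl Δ M)
    (hbuf : ∀ i, ((reg i).bufCap : ℝ) ≤ ε * (reg i).payCap)
    (hvol : ∀ i, vol (reg i).buffer ≤ (reg i).bufCap) (htl : vol tl ≤ tc) :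
    ((regStart reg (sizeClass Δ + 1) + tc : ℕ) : ℝ) ≤ (1 + 8 * ε) * dvol M ∧
    ((∑ i ∈ Finset.range (sizeClass Δ + 1), (reg i).bufCap + tc : ℕ) : ℝ) ≤
      4 * ε * dvol M := by
  have h1 := h.sum_payCap_le
  have h2 := h.tailCap_le
  have h3 : ((∑ i ∈ Finset.range (sizeClass Δ + 1), (reg i).bufCap : ℕ) : ℝ) ≤
      ε * (∑ i ∈ Finset.range (sizeClass Δ + 1), (reg i).payCap : ℕ) := by
    push_cast; rw [Finset.mul_sum]; exact Finset.sum_le_sum fun i _ => hbuf i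
  have h4 : ∑ j ∈ Finset.range (sizeClass Δ + 1), vol (reg j).buffer ≤
      ∑ i ∈ Finset.range (sizeClass Δ + 1), (reg i).bufCap :=
    Finset.sum_le_sum fun i _ => hvol i
  rw [regStart_eq]
  generalize ∑ i ∈ Finset.range (sizeClass Δ + 1), (reg i).bufCap = B at *
  generalize ∑ i ∈ Finset.range (sizeClass Δ + 1), (reg i).payCap = P at *
  generalize ∑ j ∈ Finset.range (sizeClass Δ + 1), vol (reg j).buffer = β at *
  have := layout_bound (P := P) (B := B) (β := β) (t := tc) (τ := vol tl) (V := dvol M) hε hε'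
    (by positivity) (by positivity) h3 (by exact_mod_cast h4) (by exact_mod_cast htl)
    (by exact_mod_cast h1) (by exact_mod_cast h2)
  push_cast
  exact this

/-! ### Storing items in buffers -/

/-- Apply `f` to all items in the regions. -/
def mapReg (f : Item → Item) (reg : ℕ → Region) (i : ℕ) : Region :=
  { reg i with payload := (reg i).payload.map f, buffer := (reg i).buffer.map f }

lemma regStart_mapReg (f : Item → Item) (reg : ℕ → Region) (i : ℕ) :
    regStart (mapReg f reg) i = regStart reg i := rfl

/-- Turning the object `n` into a hole. -/
def bury (n : ℕ) (x : Item) : Item :=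
  if x.name = n ∧ x.kind = .live then { x with kind := .dead } else x

lemma bury_size (n : ℕ) (x : Item) : (bury n x).size = x.size := by
  unfold bury; split <;> rfl

lemma bury_addr (n : ℕ) (x : Item) : (bury n x).addr = x.addr := by
  unfold bury; split <;> rfl

lemma key_map_bury (n : ℕ) (l : List Item) :
    key (l.map (bury n)) = (key l).filter fun p => p.1 ≠ n := by
  induction l with
  | nil => rfl
  | cons x l ih =>
    rw [List.map_cons, key_cons, ih, key_cons x, Multiset.filter_add]
    congr 1
    rw [key_singleton, key_singleton]
    by_cases h : x.kind = .live <;> by_cases h' : x.name = n <;>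
      simp [bury, h, h', Multiset.filter_singleton]

lemma filter_sum {ι α : Type*} (t : Finset ι) (f : ι → Multiset α) (p : α → Prop)
    [DecidablePred p] : (∑ j ∈ t, f j).filter p = ∑ j ∈ t, (f j).filter p := by
  classical
  induction t using Finset.induction_on with
  | empty => simp
  | insert a t ha ih => simp [Finset.sum_insert ha, ih]

lemma Shape.bury {ε : ℝ} {ex reg tc tl Δ D} (h : Shape ε ex reg tc tl Δ D) (n : ℕ) :
    Shape ε ex (mapReg (bury n) reg) tc (tl.map (bury n)) Δ
      (D.filter fun p => p.1 ≠ n) where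
  nodup := Multiset.nodup_of_le (Multiset.map_le_map (Multiset.filter_le _ _)) h.nodup
  size_mem p hp := h.size_mem p (Multiset.mem_of_mem_filter hp)
  content_eq := by
    rw [← h.content_eq]
    simp only [content, mapReg, key_map_bury, Multiset.filter_add, filter_sum]
  beyond i hi := by simp [mapReg, h.beyond i hi]
  payload_class i x hx := by
    obtain ⟨y, hy, rfl⟩ := List.mem_map.1 hx
    rw [bury_size]; exact h.payload_class i y hy
  buffer_class i x hx := by
    obtain ⟨y, hy, rfl⟩ := List.mem_map.1 hx
    rw [bury_size]; exact h.buffer_class i y hy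
  payload_end i x hx := by
    obtain ⟨y, hy, rfl⟩ := List.mem_map.1 hx
    rw [bury_size, bury_addr]; exact h.payload_end i y hy
  buffer_end i x hx := by
    obtain ⟨y, hy, rfl⟩ := List.mem_map.1 hx
    rw [bury_size, bury_addr]; exact h.buffer_end i y hy
  tail_end x hx := by
    obtain ⟨y, hy, rfl⟩ := List.mem_map.1 hx
    rw [bury_size, bury_addr]; exact h.tail_end y hy
  bufCap_le := h.bufCap_le
  buffer_vol i := by
    simpa only [mapReg, vol_map _ (bury_size n)] using h.buffer_vol i
  tail_vol := by rw [vol_map _ (bury_size n)]; exact h.tail_vol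

/-- A hole keeps its size and class and goes on paying if it lies in a buffer. The multiset `M`
still contains the deleted object here; it is exchanged for the delete record when that is stored.
-/
lemma Budget.bury {ε : ℝ} {reg tc tl Δ M} (h : Budget ε reg tc tl Δ M) (n : ℕ) :
    Budget ε (mapReg (bury n) reg) tc (tl.map (bury n)) Δ M where
  payCap_le i := by
    simpa only [mapReg, vol_ofClass_map _ _ (bury_size n)] using h.payCap_le i
  tailCap_le := by
    simpa only [mapReg, vol_map _ (bury_size n)] using h.tailCap_le

/-- Append `x` to the buffer of class `j`. -/
def pushReg (reg : ℕ → Region) (j : ℕ) (x : Item) : ℕ → Region :=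
  Function.update reg j { reg j with buffer := (reg j).buffer ++ [x] }

lemma pushReg_cases (reg : ℕ → Region) (j : ℕ) (x : Item) (i : ℕ) :
    (pushReg reg j x i).payCap = (reg i).payCap ∧ (pushReg reg j x i).bufCap = (reg i).bufCap ∧
    (pushReg reg j x i).payload = (reg i).payload ∧
    (pushReg reg j x i).buffer = (reg i).buffer ++ if i = j then [x] else [] := by
  by_cases h : i = j
  · subst h; simp [pushReg]
  · simp [pushReg, h]

lemma regStart_pushReg (reg : ℕ → Region) (j : ℕ) (x : Item) (i : ℕ) :
    regStart (pushReg reg j x) i = regStart reg i :=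
  regStart_congr fun k _ => ⟨(pushReg_cases reg j x k).1, (pushReg_cases reg j x k).2.1⟩

/-- Covers objects and delete records alike: for a record `key [x]` is zero and `D'` is `D`. -/
lemma Shape.pushReg {ε : ℝ} {ex reg tc tl Δ D} {D' : Multiset (ℕ × ℕ)} {j : ℕ} {x : Item}
    (h : Shape ε ex reg tc tl Δ D) (hj : j ≤ sizeClass Δ) (hxj : sizeClass x.size ≤ j)
    (hfit : vol (reg j).buffer + x.size ≤ (reg j).bufCap)
    (ha : x.addr = regStart reg j + (reg j).payCap + vol (reg j).buffer)
    (hD : key [x] + D = D') (hnd : (D'.map Prod.fst).Nodup)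
    (hsz : ∀ p ∈ D', 1 ≤ p.2 ∧ p.2 ≤ Δ) :
    Shape ε ex (pushReg reg j x) tc tl Δ D' where
  nodup := hnd
  size_mem := hsz
  content_eq := by
    rw [← hD, ← h.content_eq]
    have : ∀ i, key (StorageRealloc.pushReg reg j x i).payload +
        key (StorageRealloc.pushReg reg j x i).buffer =
        (if i = j then key [x] else 0) + (key (reg i).payload + key (reg i).buffer) := by
      intro i
      rw [(pushReg_cases reg j x i).2.2.1, (pushReg_cases reg j x i).2.2.2]
      split
      · rw [key_append]; abel
      · simp
    simp only [content, this, Finset.sum_add_distrib, Finset.sum_ite_eq']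
    rw [if_pos (by simpa [Nat.lt_succ_iff] using hj)]
    abel
  beyond i hi := by
    rw [StorageRealloc.pushReg, Function.update_of_ne (by omega)]; exact h.beyond i hi
  payload_class i y hy := by
    rw [(pushReg_cases reg j x i).2.2.1] at hy; exact h.payload_class i y hy
  buffer_class i y hy := by
    rw [(pushReg_cases reg j x i).2.2.2, List.mem_append] at hy
    rcases hy with hy | hy
    · exact h.buffer_class i y hy
    · split at hy
      · rw [List.mem_singleton.1 hy]; omega
      · simp at hy
  payload_end i y hy := by
    rw [(pushReg_cases reg j x i).2.2.1] at hy
    rw [regStart_pushReg]; exact h.payload_end i y hy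
  buffer_end i y hy := by
    rw [regStart_pushReg]
    rw [(pushReg_cases reg j x i).2.2.2, List.mem_append] at hy
    rcases hy with hy | hy
    · exact h.buffer_end i y hy
    · split at hy
      · rename_i hij
        rw [List.mem_singleton.1 hy, ha, hij, regStart_succ]; omega
      · simp at hy
  tail_end y hy := by rw [regStart_pushReg]; exact h.tail_end y hy
  bufCap_le i := by
    rw [(pushReg_cases reg j x i).1, (pushReg_cases reg j x i).2.1]; exact h.bufCap_le i
  buffer_vol i := by
    rw [(pushReg_cases reg j x i).2.1, (pushReg_cases reg j x i).2.2.2]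
    split
    · rename_i hij; subst hij; simpa using hfit
    · simpa using h.buffer_vol i
  tail_vol := h.tail_vol

lemma vol_ofClass_singleton (i : ℕ) (x : Item) :
    vol (ofClass i [x]) = if sizeClass x.size = i then x.size else 0 := by
  rw [ofClass_cons]; split <;> simp

/-- The exchange behind the amortization: an item in a buffer pays exactly what an object of the
same length paid, in the same class. -/
lemma Budget.pushReg {ε : ℝ} {reg tc tl Δ M} {n j : ℕ} {x : Item} (hj : j ≤ sizeClass Δ)
    (h : Budget ε reg tc tl Δ ((n, x.size) ::ₘ M)) :
    Budget ε (pushReg reg j x) tc tl Δ M where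
  payCap_le i := by
    have h1 := h.payCap_le i
    have h2 : ∀ k, vol (ofClass i (StorageRealloc.pushReg reg j x k).buffer) =
        vol (ofClass i (reg k).buffer) + if k = j then vol (ofClass i [x]) else 0 := by
      intro k
      rw [(pushReg_cases reg j x k).2.2.2]; split <;> simp
    rw [(pushReg_cases reg j x i).1]
    simp only [h2, Finset.sum_add_distrib, Finset.sum_ite_eq']
    rw [if_pos (by simpa [Nat.lt_succ_iff] using hj), vol_ofClass_singleton]
    rw [cvol_cons] at h1
    dsimp only at h1
    omega
  tailCap_le := by
    have h2 : ∀ k, vol (StorageRealloc.pushReg reg j x k).buffer =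
        vol (reg k).buffer + if k = j then x.size else 0 := by
      intro k
      rw [(pushReg_cases reg j x k).2.2.2]; split <;> simp
    refine h.tailCap_le.trans_eq ?_
    simp only [h2, Finset.sum_add_distrib, Finset.sum_ite_eq']
    rw [if_pos (by simpa [Nat.lt_succ_iff] using hj), dvol_cons]
    congr 2; ring

lemma Shape.pushTail {ε : ℝ} {ex ex' reg tc tl Δ D} {D' : Multiset (ℕ × ℕ)} {x : Item}
    (h : Shape ε ex reg tc tl Δ D) (hex : ex ≤ ex')
    (hfit : vol tl + x.size ≤ tc + ex')
    (ha : x.addr = regStart reg (sizeClass Δ + 1) + vol tl)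
    (hD : key [x] + D = D') (hnd : (D'.map Prod.fst).Nodup)
    (hsz : ∀ p ∈ D', 1 ≤ p.2 ∧ p.2 ≤ Δ) :
    Shape ε ex' reg tc (tl ++ [x]) Δ D' where
  nodup := hnd
  size_mem := hsz
  content_eq := by
    rw [← hD, ← h.content_eq]; simp only [content, key_append]; abel
  beyond := h.beyond
  payload_class := h.payload_class
  buffer_class := h.buffer_class
  payload_end := h.payload_end
  buffer_end := h.buffer_end
  tail_end y hy := by
    rcases List.mem_append.1 hy with hy | hy
    · exact (h.tail_end y hy).trans (by omega)
    · rw [List.mem_singleton.1 hy]; omega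
  bufCap_le := h.bufCap_le
  buffer_vol := h.buffer_vol
  tail_vol := by simpa using hfit

lemma Budget.pushTail {ε : ℝ} {reg tc tl Δ M} {n : ℕ} {x : Item}
    (h : Budget ε reg tc tl Δ ((n, x.size) ::ₘ M)) :
    Budget ε reg tc (tl ++ [x]) Δ M where
  payCap_le i := by
    have h1 := h.payCap_le i
    rw [cvol_cons] at h1
    rw [ofClass_append, vol_append, vol_ofClass_singleton]
    dsimp only at h1
    omega
  tailCap_le := by
    refine h.tailCap_le.trans_eq ?_
    rw [dvol_cons, vol_append]
    simp only [vol_cons, vol_nil]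
    congr 2; ring

lemma tryStore_some {ε : ℝ} {s s' : State} {x : Item} {D D' M : Multiset (ℕ × ℕ)}
    (h : Shape ε 0 s.region s.tailCap s.tail s.maxLen D)
    (hb : Budget ε s.region s.tailCap s.tail s.maxLen ((x.name, x.size) ::ₘ M))
    (hD : key [x] + D = D') (hnd : (D'.map Prod.fst).Nodup)
    (hsz : ∀ p ∈ D', 1 ≤ p.2 ∧ p.2 ≤ s.maxLen) (hs : s.tryStore x = some s') :
    ∃ reg tl, s' = { s with region := reg, tail := tl } ∧
      Shape ε 0 reg s.tailCap tl s.maxLen D' ∧ Budget ε reg s.tailCap tl s.maxLen M ∧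
      vol tl ≤ vol s.tail + x.size ∧ ∀ i, regStart reg i = regStart s.region i := by
  have hkey : ∀ a, key [{ x with addr := a }] = key [x] := fun a => by simp [key_singleton]
  unfold State.tryStore at hs
  split at hs
  · rename_i j hj
    have h1 := List.find?_some hj
    have h2 := List.mem_of_find?_eq_some hj
    simp only [decide_eq_true_eq] at h1
    have h3 : j ≤ sizeClass s.maxLen := by
      simpa [State.numClasses, Nat.lt_succ_iff] using h2
    obtain rfl := Option.some.inj hs
    refine ⟨_, s.tail, rfl, ?_, ?_, by omega, regStart_pushReg _ _ _⟩
    · exact h.pushReg h3 h1.1 h1.2 rfl (by rw [hkey, hD]) hnd hsz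
    · exact Budget.pushReg (n := x.name) h3 hb
  · split at hs
    · rename_i hfit
      obtain rfl := Option.some.inj hs
      refine ⟨s.region, _, rfl, ?_, ?_, by simp, fun _ => rfl⟩
      · exact h.pushTail le_rfl (by simpa using hfit) rfl (by rw [hkey, hD]) hnd hsz
      · exact Budget.pushTail (n := x.name) hb
    · simp at hs

lemma tryStore_ne_none {s : State} {x : Item} (h : vol s.tail + x.size ≤ s.tailCap) :
    s.tryStore x ≠ none := by
  unfold State.tryStore
  split
  · simp
  · simp [h]

/-! ### The layout during a flush -/

/-- The first cell of the region of class `i` in the layout that a flush with boundary class `b`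
brings about. -/
noncomputable def goalStart (ε : ℝ) (reg : ℕ → Region) (D : Multiset (ℕ × ℕ)) (b i : ℕ) : ℕ :=
  regStart reg b + ∑ j ∈ Finset.Ico b i, (cvol j D + bufLen ε (cvol j D))

/-- A flush with plan `p` is moving the objects `D`; `tc` is the old length of the tail buffer,
`ov` holds the objects taken over from the buffers, and everything takes place in the first `T`
cells. -/
structure Moving (ε : ℝ) (reg : ℕ → Region) (tc : ℕ) (ov : List Item) (Δ : ℕ) (p : Plan) (T : ℕ)
    (D : Multiset (ℕ × ℕ)) : Prop where
  nodup : (D.map Prod.fst).Nodup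
  size_mem : ∀ q ∈ D, 1 ≤ q.2 ∧ q.2 ≤ Δ
  content_eq : content reg (sizeClass Δ) [] + key ov = D
  beyond : ∀ i, sizeClass Δ < i → reg i = ⟨0, 0, [], []⟩
  payload_class : ∀ i, ∀ x ∈ (reg i).payload, sizeClass x.size = i
  buffer_class : ∀ i, ∀ x ∈ (reg i).buffer, sizeClass x.size ≤ i
  buffer_nil : ∀ i, p.boundary ≤ i → (reg i).buffer = []
  payload_live : ∀ i, p.boundary ≤ i → ∀ x ∈ (reg i).payload, x.kind = .live
  overflow_live : ∀ x ∈ ov, x.kind = .live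
  overflow_class : ∀ x ∈ ov, p.boundary ≤ sizeClass x.size
  boundary_le : p.boundary ≤ sizeClass Δ
  low_end : ∀ i < p.boundary, ∀ x, x ∈ (reg i).payload ∨ x ∈ (reg i).buffer →
    x.addr + x.size ≤ regStart reg (i + 1)
  low_fixed : ∀ i < p.boundary, ∀ x, x ∈ (reg i).payload ∨ x ∈ (reg i).buffer →
    x.kind = .live → ∀ m ∈ p.moves, m.name ≠ x.name
  bufCap_le : ∀ i, ((reg i).bufCap : ℝ) ≤ ε * (reg i).payCap
  buffer_vol : ∀ i, vol (reg i).buffer ≤ (reg i).bufCap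
  payCap_le : ∀ i < p.boundary, (reg i).payCap ≤ cvol i D +
    ∑ j ∈ Finset.range (sizeClass Δ + 1), vol (ofClass i (reg j).buffer)
  classVol_eq : ∀ i, p.classVol i = cvol i D
  totalVol_eq : p.totalVol = dvol D
  moves_mem : ∀ m ∈ p.moves, (m.name, m.size) ∈ D
  moves_end : ∀ m ∈ p.moves, m.target + m.size ≤ T
  -- The final address is predicted by running the outstanding moves, so the goal layout is
  -- certified before any move is made.
  payload_lands : ∀ i, p.boundary ≤ i → ∀ x ∈ (reg i).payload,
    landing p.moves x.name x.addr + x.size ≤ goalStart ε reg D p.boundary (i + 1)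
  overflow_lands : ∀ x ∈ ov, landing p.moves x.name x.addr + x.size ≤
    goalStart ε reg D p.boundary (sizeClass x.size + 1)
  item_end : ∀ i x, x ∈ (reg i).payload ∨ x ∈ (reg i).buffer → x.addr + x.size ≤ T
  overflow_end : ∀ x ∈ ov, x.addr + x.size ≤ T
  layout_end : regStart reg (sizeClass Δ + 1) + tc ≤ T
  goal_end : goalStart ε reg D p.boundary (sizeClass Δ + 1) + bufLen ε (dvol D) ≤ T

/-- The effect of a move on an item. -/
def shift (m : Move) (x : Item) : Item :=
  if x.name = m.name ∧ x.kind = .live then { x with addr := m.target } else x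

lemma shift_same (m : Move) (x : Item) : (shift m x).name = x.name ∧
    (shift m x).size = x.size ∧ (shift m x).kind = x.kind := by
  unfold shift; split <;> simp

lemma shift_of_ne {m : Move} {x : Item} (h : x.kind = .live → m.name ≠ x.name) :
    shift m x = x := by
  unfold shift
  rw [if_neg]
  rintro ⟨h1, h2⟩
  exact h h2 h1.symm

/-- Executing the first outstanding move leaves the predicted final address unchanged. -/
lemma landing_shift {m : Move} {ms : List Move} {x : Item} (h : x.kind = .live) :
    landing ms (shift m x).name (shift m x).addr = landing (m :: ms) x.name x.addr := by
  unfold shift landing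
  by_cases h' : x.name = m.name
  · simp [h, h']
  · simp [h', Ne.symm h']

lemma Moving.mem_of_payload {ε : ℝ} {reg tc ov Δ p T D} (h : Moving ε reg tc ov Δ p T D)
    {i : ℕ} {x : Item} (hx : x ∈ (reg i).payload ∨ x ∈ (reg i).buffer) (hk : x.kind = .live) :
    (x.name, x.size) ∈ D := by
  have hi : i ≤ sizeClass Δ := by
    by_contra hi
    rw [h.beyond i (by omega)] at hx
    simp at hx
  rw [← h.content_eq, content]
  simp only [Multiset.mem_add]
  left; left
  rw [Multiset.mem_sum]
  refine ⟨i, by simpa [Nat.lt_succ_iff] using hi, ?_⟩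
  rw [Multiset.mem_add]
  exact hx.imp (mem_key · hk) (mem_key · hk)

lemma Moving.mem_of_overflow {ε : ℝ} {reg tc ov Δ p T D} (h : Moving ε reg tc ov Δ p T D)
    {x : Item} (hx : x ∈ ov) : (x.name, x.size) ∈ D := by
  rw [← h.content_eq, Multiset.mem_add]
  exact .inr (mem_key hx (h.overflow_live x hx))

/-- Landing predictions survive by `landing_shift`, regions below the boundary are untouched by
`low_fixed`, and the target of the move lies in front of `T`. -/
lemma Moving.relocate {ε : ℝ} {reg tc ov Δ b cv tv T D} {m : Move} {ms : List Move}
    (h : Moving ε reg tc ov Δ ⟨b, cv, tv, m :: ms⟩ T D) :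
    Moving ε (mapReg (shift m) reg) tc (ov.map (shift m)) Δ ⟨b, cv, tv, ms⟩ T D where
  nodup := h.nodup
  size_mem := h.size_mem
  content_eq := by
    rw [← h.content_eq]
    simp only [content, mapReg, key_map _ (shift_same m)]
  beyond i hi := by simp [mapReg, h.beyond i hi]
  payload_class i x hx := by
    obtain ⟨y, hy, rfl⟩ := List.mem_map.1 hx
    rw [(shift_same m y).2.1]; exact h.payload_class i y hy
  buffer_class i x hx := by
    obtain ⟨y, hy, rfl⟩ := List.mem_map.1 hx
    rw [(shift_same m y).2.1]; exact h.buffer_class i y hy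
  buffer_nil i hi := by simpa [mapReg] using h.buffer_nil i hi
  payload_live i hi x hx := by
    obtain ⟨y, hy, rfl⟩ := List.mem_map.1 hx
    rw [(shift_same m y).2.2]; exact h.payload_live i hi y hy
  overflow_live x hx := by
    obtain ⟨y, hy, rfl⟩ := List.mem_map.1 hx
    rw [(shift_same m y).2.2]; exact h.overflow_live y hy
  overflow_class x hx := by
    obtain ⟨y, hy, rfl⟩ := List.mem_map.1 hx
    rw [(shift_same m y).2.1]; exact h.overflow_class y hy
  boundary_le := h.boundary_le
  low_end i hi x hx := by
    have : x ∈ (reg i).payload ∨ x ∈ (reg i).buffer := by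
      rcases hx with hx | hx <;> obtain ⟨y, hy, rfl⟩ := List.mem_map.1 hx
      · rw [shift_of_ne fun hk => h.low_fixed i hi y (.inl hy) hk m (by simp)]
        exact .inl hy
      · rw [shift_of_ne fun hk => h.low_fixed i hi y (.inr hy) hk m (by simp)]
        exact .inr hy
    rw [regStart_mapReg]
    exact h.low_end i hi x this
  low_fixed i hi x hx hk m' hm' := by
    rcases hx with hx | hx <;> obtain ⟨y, hy, rfl⟩ := List.mem_map.1 hx <;>
      rw [(shift_same m y).2.2] at hk <;> rw [(shift_same m y).1]
    · exact h.low_fixed i hi y (.inl hy) hk m' (by simp [hm'])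
    · exact h.low_fixed i hi y (.inr hy) hk m' (by simp [hm'])
  bufCap_le := h.bufCap_le
  buffer_vol i := by
    simpa only [mapReg, vol_map _ fun x => (shift_same m x).2.1] using h.buffer_vol i
  payCap_le i hi := by
    simpa only [mapReg, vol_ofClass_map _ _ fun x => (shift_same m x).2.1] using h.payCap_le i hi
  classVol_eq := h.classVol_eq
  totalVol_eq := h.totalVol_eq
  moves_mem m' hm' := h.moves_mem m' (by simp [hm'])
  moves_end m' hm' := h.moves_end m' (by simp [hm'])
  payload_lands i hi x hx := by
    obtain ⟨y, hy, rfl⟩ := List.mem_map.1 hx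
    rw [landing_shift (h.payload_live i hi y hy), (shift_same m y).2.1]
    exact h.payload_lands i hi y hy
  overflow_lands x hx := by
    obtain ⟨y, hy, rfl⟩ := List.mem_map.1 hx
    rw [landing_shift (h.overflow_live y hy), (shift_same m y).2.1]
    exact h.overflow_lands y hy
  item_end i x hx := by
    have : ∀ y, (y ∈ (reg i).payload ∨ y ∈ (reg i).buffer) →
        (shift m y).addr + (shift m y).size ≤ T := by
      intro y hy
      by_cases hm : y.name = m.name ∧ y.kind = .live
      · have h1 := h.mem_of_payload hy hm.2
        rw [hm.1] at h1
        -- Items are addressed by name; distinctness of names makes the size in the move that of the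
        -- item.
        have h2 := eq_snd_of_nodup h.nodup h1 (h.moves_mem m (by simp))
        have h3 := h.moves_end m (by simp)
        simp only [shift, if_pos hm]; omega
      · simp only [shift, if_neg hm]; exact h.item_end i y hy
    rcases hx with hx | hx <;> obtain ⟨y, hy, rfl⟩ := List.mem_map.1 hx
    · exact this y (.inl hy)
    · exact this y (.inr hy)
  overflow_end x hx := by
    obtain ⟨y, hy, rfl⟩ := List.mem_map.1 hx
    by_cases hm : y.name = m.name ∧ y.kind = .live
    · have h1 := h.mem_of_overflow hy
      rw [hm.1] at h1
      have h2 := eq_snd_of_nodup h.nodup h1 (h.moves_mem m (by simp))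
      have h3 := h.moves_end m (by simp)
      simp only [shift, if_pos hm]; omega
    · simp only [shift, if_neg hm]; exact h.overflow_end y hy
  layout_end := h.layout_end
  goal_end := h.goal_end

/-- The regions after the end of the moves. -/
noncomputable def goalReg (ε : ℝ) (reg : ℕ → Region) (p : Plan) (ov : List Item) (i : ℕ) : Region :=
  if p.boundary ≤ i then
    { payCap := p.classVol i
      bufCap := bufLen ε (p.classVol i)
      payload := (reg i).payload ++ ofClass i ov
      buffer := [] }
  else reg i

lemma bufLen_le {ε : ℝ} (hε : 0 < ε) (v : ℕ) : (bufLen ε v : ℝ) ≤ ε * v :=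
  Nat.floor_le (by positivity)

lemma regStart_goalReg_low {ε : ℝ} {reg : ℕ → Region} {p : Plan} {ov : List Item} {i : ℕ}
    (hi : i ≤ p.boundary) : regStart (goalReg ε reg p ov) i = regStart reg i :=
  regStart_congr fun j hj => by simp [goalReg, show ¬ p.boundary ≤ j by omega]

lemma regStart_goalReg {ε : ℝ} {reg : ℕ → Region} {p : Plan} {ov : List Item} {i : ℕ}
    {D : Multiset (ℕ × ℕ)} (hD : ∀ i, p.classVol i = cvol i D) (hi : p.boundary ≤ i) :
    regStart (goalReg ε reg p ov) i = goalStart ε reg D p.boundary i := by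
  rw [goalStart, ← regStart_goalReg_low (ε := ε) (ov := ov) le_rfl, regStart, regStart,
    ← Finset.sum_range_add_sum_Ico _ hi]
  congr 1
  refine Finset.sum_congr rfl fun j hj => ?_
  rw [goalReg, if_pos (Finset.mem_Ico.1 hj).1, hD]

lemma sum_key_ofClass {b n : ℕ} {l : List Item}
    (h : ∀ x ∈ l, b ≤ sizeClass x.size ∧ sizeClass x.size ≤ n) :
    ∑ i ∈ Finset.range (n + 1), (if b ≤ i then key (ofClass i l) else 0) = key l := by
  induction l with
  | nil => simp
  | cons x l ih =>
    have h1 : ∀ i, (if b ≤ i then key (ofClass i (x :: l)) else 0) =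
        (if sizeClass x.size = i then key [x] else 0) +
          if b ≤ i then key (ofClass i l) else 0 := by
      intro i
      have hx := h x (by simp)
      rw [ofClass_cons]
      by_cases h2 : sizeClass x.size = i
      · rw [if_pos (by omega), if_pos h2, if_pos h2, if_pos (by omega), key_cons]
      · simp [h2]
    simp only [h1, Finset.sum_add_distrib, Finset.sum_ite_eq]
    rw [if_pos (by have := (h x (by simp)).2; simp; omega), ih fun y hy => h y (by simp [hy]),
      ← key_cons]

/-- Classes from the boundary on receive exactly their volume, so only the lower ones need an
assumption. Used at the start of a flush to bound the end of the goal layout, and again when that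
layout is installed. -/
lemma budget_goalReg {ε : ℝ} {reg Δ p} {ov : List Item} {D : Multiset (ℕ × ℕ)} (hε : 0 < ε)
    (hcap : ∀ i < p.boundary, (reg i).payCap ≤ cvol i D +
      ∑ j ∈ Finset.range (sizeClass Δ + 1), vol (ofClass i (reg j).buffer))
    (hnil : ∀ i, p.boundary ≤ i → (reg i).buffer = [])
    (hcv : ∀ i, p.classVol i = cvol i D) (htv : p.totalVol = dvol D) :
    Budget ε (goalReg ε reg p ov) (bufLen ε p.totalVol) [] Δ D where
  payCap_le i := by
    have h1 : ∀ j, (goalReg ε reg p ov j).buffer = (reg j).buffer := by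
      intro j
      unfold goalReg
      split
      · rename_i hj; rw [hnil j hj]
      · rfl
    simp only [h1, ofClass_nil, vol_nil, add_zero]
    by_cases hi : p.boundary ≤ i
    · simp only [goalReg, if_pos hi, hcv]; omega
    · simp only [goalReg, if_neg hi]; exact hcap i (by omega)
  tailCap_le := by
    rw [htv]
    refine (bufLen_le hε _).trans ?_
    gcongr
    omega

lemma goalReg_bufCap_le {ε : ℝ} {reg : ℕ → Region} {p} {ov : List Item} (hε : 0 < ε)
    (h : ∀ i, ((reg i).bufCap : ℝ) ≤ ε * (reg i).payCap) (i : ℕ) :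
    ((goalReg ε reg p ov i).bufCap : ℝ) ≤ ε * (goalReg ε reg p ov i).payCap := by
  unfold goalReg
  split
  · exact bufLen_le hε _
  · exact h i

lemma goalReg_buffer_vol {ε : ℝ} {reg : ℕ → Region} {p} {ov : List Item}
    (h : ∀ i, vol (reg i).buffer ≤ (reg i).bufCap) (i : ℕ) :
    vol (goalReg ε reg p ov i).buffer ≤ (goalReg ε reg p ov i).bufCap := by
  unfold goalReg
  split
  · simp
  · exact h i

lemma Moving.class_le {ε : ℝ} {reg tc ov Δ p T D} (h : Moving ε reg tc ov Δ p T D)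
    {x : Item} (hx : x ∈ ov) : sizeClass x.size ≤ sizeClass Δ :=
  sizeClass_mono (h.size_mem _ (h.mem_of_overflow hx)).2

/-- With no moves left, the predicted addresses are the actual ones. -/
lemma Moving.install {ε : ℝ} {reg tc ov Δ p T D} (hε : 0 < ε) (h : Moving ε reg tc ov Δ p T D)
    (hm : p.moves = []) :
    Shape ε 0 (goalReg ε reg p ov) (bufLen ε p.totalVol) [] Δ D where
  nodup := h.nodup
  size_mem := h.size_mem
  content_eq := by
    rw [← h.content_eq, ← sum_key_ofClass fun x hx => ⟨h.overflow_class x hx, h.class_le hx⟩,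
      content, content]
    simp only [key_nil, add_zero]
    rw [← Finset.sum_add_distrib]
    refine Finset.sum_congr rfl fun i _ => ?_
    unfold goalReg
    split
    · rename_i hi; simp [h.buffer_nil i hi]
    · simp
  beyond i hi := by
    have hb := h.boundary_le
    have h1 : ofClass i ov = [] := by
      simp only [ofClass, List.filter_eq_nil_iff, decide_eq_true_eq]
      intro x hx
      have := h.class_le hx
      omega
    have h2 : cvol i D = 0 := cvol_eq_zero fun q hq => by
      have := sizeClass_mono (h.size_mem q hq).2
      omega
    rw [goalReg, if_pos (by omega), h.classVol_eq, h2, h.beyond i hi, h1]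
    simp [bufLen]
  payload_class i x hx := by
    unfold goalReg at hx
    split at hx
    · rcases List.mem_append.1 hx with hx | hx
      · exact h.payload_class i x hx
      · exact (mem_ofClass.1 hx).2
    · exact h.payload_class i x hx
  buffer_class i x hx := by
    unfold goalReg at hx
    split at hx
    · simp at hx
    · exact h.buffer_class i x hx
  payload_end i x hx := by
    by_cases hi : p.boundary ≤ i
    · rw [regStart_goalReg h.classVol_eq (by omega)]
      rw [goalReg, if_pos hi] at hx
      rcases List.mem_append.1 hx with hx | hx
      · simpa [hm, landing] using h.payload_lands i hi x hx
      · obtain ⟨hx', rfl⟩ := mem_ofClass.1 hx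
        simpa [hm, landing] using h.overflow_lands x hx'
    · rw [regStart_goalReg_low (by omega)]
      rw [goalReg, if_neg hi] at hx
      exact h.low_end i (by omega) x (.inl hx)
  buffer_end i x hx := by
    by_cases hi : p.boundary ≤ i
    · simp [goalReg, if_pos hi] at hx
    · rw [regStart_goalReg_low (by omega)]
      rw [goalReg, if_neg hi] at hx
      exact h.low_end i (by omega) x (.inr hx)
  tail_end x hx := by simp at hx
  bufCap_le := goalReg_bufCap_le hε h.bufCap_le
  buffer_vol := goalReg_buffer_vol h.buffer_vol
  tail_vol := by simp

/-! ### The start of a flush -/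

/-- The regions at the start of a flush with boundary class `b`. -/
def flushReg (reg : ℕ → Region) (b i : ℕ) : Region :=
  if b ≤ i then { reg i with payload := live (reg i).payload, buffer := [] } else reg i

lemma flushReg_caps (reg : ℕ → Region) (b i : ℕ) :
    (flushReg reg b i).payCap = (reg i).payCap ∧ (flushReg reg b i).bufCap = (reg i).bufCap := by
  unfold flushReg; split <;> simp

lemma regStart_flushReg (reg : ℕ → Region) (b i : ℕ) :
    regStart (flushReg reg b) i = regStart reg i :=
  regStart_congr fun j _ => flushReg_caps reg b j

lemma flushReg_payload_subset {reg : ℕ → Region} {b i : ℕ} {x : Item}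
    (h : x ∈ (flushReg reg b i).payload) : x ∈ (reg i).payload := by
  unfold flushReg at h
  split at h
  · exact (mem_live.1 h).1
  · exact h

lemma flushReg_buffer_subset {reg : ℕ → Region} {b i : ℕ} {x : Item}
    (h : x ∈ (flushReg reg b i).buffer) : x ∈ (reg i).buffer := by
  unfold flushReg at h
  split at h
  · simp at h
  · exact h

lemma key_buffered (s : State) (b : ℕ) : key (s.buffered b) =
    ∑ i ∈ Finset.Ico b (sizeClass s.maxLen + 1), key (s.region i).buffer + key s.tail := by
  rw [State.buffered, key_append, key_flatMap, key_live, State.classesFrom, State.numClasses,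
    sum_map_range']
  simp

lemma mem_classesFrom {s : State} {b i : ℕ} :
    i ∈ s.classesFrom b ↔ b ≤ i ∧ i ≤ sizeClass s.maxLen := by
  simp only [State.classesFrom, State.numClasses, List.mem_range'_1]
  omega

lemma mem_buffered {s : State} {b : ℕ} {x : Item} : x ∈ s.buffered b ↔
    ((∃ i, b ≤ i ∧ i ≤ sizeClass s.maxLen ∧ x ∈ (s.region i).buffer) ∨ x ∈ s.tail) ∧
      x.kind = .live := by
  simp only [State.buffered, List.mem_append, List.mem_flatMap, mem_classesFrom, mem_live]
  constructor
  · rintro (⟨i, hi, hx, hk⟩ | ⟨hx, hk⟩)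
    · exact ⟨.inl ⟨i, hi.1, hi.2, hx⟩, hk⟩
    · exact ⟨.inr hx, hk⟩
  · rintro ⟨⟨i, h1, h2, hx⟩ | hx, hk⟩
    · exact .inl ⟨i, ⟨h1, h2⟩, hx, hk⟩
    · exact .inr ⟨hx, hk⟩

lemma boundary_spec (s : State) (w : ℕ) :
    s.Admissible (s.boundary w) ∧ s.boundary w ≤ sizeClass w :=
  -- Class 0 is always admissible, so the search cannot fail.
  ⟨Nat.findGreatest_spec (P := s.Admissible) (Nat.zero_le _) ⟨by simp, by simp⟩,
    Nat.findGreatest_le _⟩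

lemma content_flushReg {s : State} {b : ℕ} (hb : b ≤ sizeClass s.maxLen) :
    content (flushReg s.region b) (sizeClass s.maxLen) [] + key (s.buffered b) =
      content s.region (sizeClass s.maxLen) s.tail := by
  rw [key_buffered, content, content, ← Finset.sum_range_add_sum_Ico _ (by omega : b ≤ _ + 1),
    ← Finset.sum_range_add_sum_Ico (fun i => key (s.region i).payload + key (s.region i).buffer)
      (by omega : b ≤ _ + 1)]
  have h1 : ∀ i ∈ Finset.range b, key (flushReg s.region b i).payload +
      key (flushReg s.region b i).buffer = key (s.region i).payload + key (s.region i).buffer := by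
    intro i hi
    rw [flushReg, if_neg (by simpa using hi)]
  have h2 : ∀ i ∈ Finset.Ico b (sizeClass s.maxLen + 1), key (flushReg s.region b i).payload +
      key (flushReg s.region b i).buffer = key (s.region i).payload := by
    intro i hi
    rw [flushReg, if_pos (Finset.mem_Ico.1 hi).1]
    simp
  rw [Finset.sum_congr rfl h1, Finset.sum_congr rfl h2,
    Finset.sum_add_distrib (s := Finset.Ico _ _)]
  simp only [key_nil]
  abel

lemma Shape.classVol_eq {ε : ℝ} {ex : ℕ} {s : State} {D : Multiset (ℕ × ℕ)}
    (h : Shape ε ex s.region s.tailCap s.tail s.maxLen D) (i : ℕ) :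
    s.classVol i = cvol i D := by
  rw [State.classVol, vol_ofClass_live_eq, key_mainItems, h.content_eq]

lemma Shape.totalVol_eq {ε : ℝ} {ex : ℕ} {s : State} {D : Multiset (ℕ × ℕ)}
    (h : Shape ε ex s.region s.tailCap s.tail s.maxLen D) : s.totalVol = dvol D := by
  rw [State.totalVol, vol_live_eq, key_mainItems, h.content_eq]

lemma goalStart_flushReg (ε : ℝ) (reg : ℕ → Region) (D : Multiset (ℕ × ℕ)) (b b' i : ℕ) :
    goalStart ε (flushReg reg b') D b i = goalStart ε reg D b i := by
  rw [goalStart, goalStart, regStart_flushReg]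

lemma goalStart_succ (ε : ℝ) (reg : ℕ → Region) (D : Multiset (ℕ × ℕ)) {b i : ℕ} (h : b ≤ i) :
    goalStart ε reg D b (i + 1) =
      goalStart ε reg D b i + (cvol i D + bufLen ε (cvol i D)) := by
  rw [goalStart, goalStart, Finset.sum_Ico_succ_top h, add_assoc]

lemma goalStart_mono (ε : ℝ) (reg : ℕ → Region) (D : Multiset (ℕ × ℕ)) {b i j : ℕ} (h : i ≤ j) :
    goalStart ε reg D b i ≤ goalStart ε reg D b j := by
  unfold goalStart
  gcongr

lemma Shape.newStart_eq {ε : ℝ} {ex : ℕ} {s : State} {D : Multiset (ℕ × ℕ)}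
    (h : Shape ε ex s.region s.tailCap s.tail s.maxLen D) (b i : ℕ) :
    s.newStart ε b i = goalStart ε s.region D b i := by
  simp only [State.newStart, h.classVol_eq]
  rfl

lemma Shape.newEnd_eq {ε : ℝ} {ex : ℕ} {s : State} {D : Multiset (ℕ × ℕ)}
    (h : Shape ε ex s.region s.tailCap s.tail s.maxLen D) (b : ℕ) :
    s.newEnd ε b = goalStart ε s.region D b (sizeClass s.maxLen + 1) + bufLen ε (dvol D) := by
  rw [State.newEnd, h.newStart_eq, h.totalVol_eq]
  rfl

section StartFlush

variable {ε : ℝ} {ex : ℕ} {s : State} {D : Multiset (ℕ × ℕ)}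

/-- The live objects in the payload segments of the classes from `b` on. -/
def State.flushedPayload (s : State) (b : ℕ) : List Item :=
  (s.classesFrom b).flatMap fun i => live (s.region i).payload

lemma vol_flushedPayload (s : State) (b : ℕ) : vol (s.flushedPayload b) =
    ∑ i ∈ Finset.Ico b (sizeClass s.maxLen + 1), vol (live (s.region i).payload) := by
  rw [State.flushedPayload, vol_flatMap, State.classesFrom, State.numClasses, sum_map_range']

lemma vol_buffered_eq (s : State) (b : ℕ) : vol (s.buffered b) = dvol (key (s.buffered b)) := by
  rw [← vol_live_eq, live_eq_self fun x hx => (mem_buffered.1 hx).2]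

lemma vol_buffered_le (s : State) (b : ℕ) : vol (s.buffered b) ≤
    ∑ i ∈ Finset.Ico b (sizeClass s.maxLen + 1), vol (s.region i).buffer + vol s.tail := by
  rw [State.buffered, vol_append, vol_flatMap, State.classesFrom, State.numClasses,
    sum_map_range']
  exact Nat.add_le_add (Finset.sum_le_sum fun i _ => vol_live_le _) (vol_live_le _)

lemma flushedBufs_eq (s : State) (b : ℕ) : s.flushedBufs b =
    ∑ i ∈ Finset.Ico b (sizeClass s.maxLen + 1), (s.region i).bufCap + s.tailCap := by
  rw [State.flushedBufs, State.classesFrom, State.numClasses, sum_map_range']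

lemma Shape.vol_flushed_le (h : Shape ε ex s.region s.tailCap s.tail s.maxLen D) {b : ℕ}
    (hb : b ≤ sizeClass s.maxLen) : vol (s.flushedPayload b) + vol (s.buffered b) ≤ dvol D := by
  rw [← h.content_eq, ← content_flushReg hb, dvol_add, ← vol_buffered_eq, vol_flushedPayload,
    content, key_nil, add_zero, dvol_sum, ← Finset.sum_range_add_sum_Ico _ (by omega : b ≤ _ + 1)]
  have : ∀ i ∈ Finset.Ico b (sizeClass s.maxLen + 1), vol (live (s.region i).payload) ≤
      dvol (key (flushReg s.region b i).payload + key (flushReg s.region b i).buffer) := by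
    intro i hi
    rw [flushReg, if_pos (Finset.mem_Ico.1 hi).1, vol_live_eq]
    simp
  have := Finset.sum_le_sum this
  omega

/-- Guarantees that the old payload objects followed by the buffered ones fit into the new payload
segment of their class. -/
lemma Shape.vol_class_le (h : Shape ε ex s.region s.tailCap s.tail s.maxLen D) {b i : ℕ}
    (hi : b ≤ i) (hi' : i ≤ sizeClass s.maxLen) :
    vol (live (s.region i).payload) + vol (ofClass i (s.buffered b)) ≤ cvol i D := by
  rw [← h.content_eq, ← content_flushReg (hi.trans hi'), cvol_add, ← vol_ofClass_live_eq,
    live_eq_self (l := s.buffered b) fun x hx => (mem_buffered.1 hx).2, content, key_nil, add_zero,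
    cvol_sum]
  gcongr
  refine le_trans ?_ (Finset.single_le_sum (fun _ _ => Nat.zero_le _)
    (by simpa [Nat.lt_succ_iff] using hi'))
  rw [flushReg, if_pos hi, cvol_add, ← vol_ofClass_live_eq]
  simp only [live_live]
  rw [ofClass_eq_self fun x hx => h.payload_class i x (mem_live.1 hx).1]
  omega

/-- Every flushed object moves twice: once into the working space and once to its final place. -/
lemma Shape.moveVol_flushMoves_le (h : Shape ε ex s.region s.tailCap s.tail s.maxLen D)
    {b : ℕ} (hb : b ≤ sizeClass s.maxLen) (ins : ℕ) :
    moveVol (s.flushMoves ε b ins) ≤ 2 * dvol D := by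
  have h1 := h.vol_flushed_le hb
  have h2 : vol (s.flushedPayload b) =
      ((s.classesFrom b).map fun i => vol (live (s.region i).payload)).sum := vol_flatMap _ _
  have h3 : ((s.classesFrom b).map fun i => vol (ofClass i (s.buffered b))).sum ≤
      vol (s.buffered b) := by
    rw [State.classesFrom, State.numClasses, sum_map_range']
    exact sum_vol_ofClass_le _ _
  simp only [State.flushMoves, moveVol_append, moveVol_reverse, moveVol_flatMap, moveVol_layFrom]
  change _ + vol (s.flushedPayload b) + _ + _ ≤ _
  omega

lemma Shape.mem_of_payload (h : Shape ε ex s.region s.tailCap s.tail s.maxLen D) {i : ℕ}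
    {x : Item} (hx : x ∈ (s.region i).payload ∨ x ∈ (s.region i).buffer) (hk : x.kind = .live) :
    (x.name, x.size) ∈ D := by
  have hi : i ≤ sizeClass s.maxLen := by
    by_contra hi
    rw [h.beyond i (by omega)] at hx
    simp at hx
  rw [← h.content_eq, content]
  simp only [Multiset.mem_add]
  left
  rw [Multiset.mem_sum]
  refine ⟨i, by simpa [Nat.lt_succ_iff] using hi, ?_⟩
  rw [Multiset.mem_add]
  exact hx.imp (mem_key · hk) (mem_key · hk)

lemma Shape.mem_of_buffered (h : Shape ε ex s.region s.tailCap s.tail s.maxLen D) {b : ℕ}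
    {x : Item} (hx : x ∈ s.buffered b) : (x.name, x.size) ∈ D := by
  obtain ⟨⟨i, -, -, hx⟩ | hx, hk⟩ := mem_buffered.1 hx
  · exact h.mem_of_payload (.inr hx) hk
  · rw [← h.content_eq, content, Multiset.mem_add]
    exact .inr (mem_key hx hk)

lemma buffered_class {b : ℕ} (ha : s.Admissible b) {x : Item} (hx : x ∈ s.buffered b) :
    b ≤ sizeClass x.size := by
  obtain ⟨⟨i, h1, h2, hx⟩ | hx, hk⟩ := mem_buffered.1 hx
  · exact ha.2 i (by simpa [State.numClasses, Nat.lt_succ_iff] using h2) h1 x hx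
  · exact ha.1 x hx

/-- The moves that bring the objects to their final places. -/
noncomputable def State.finalMoves (ε : ℝ) (s : State) (b : ℕ) : List Move :=
  (s.classesFrom b).flatMap (fun i =>
    layFrom (s.newStart ε b i) (live (s.region i).payload)) ++
  (s.classesFrom b).flatMap (fun i =>
    layFrom (s.newStart ε b i + vol (live (s.region i).payload)) (ofClass i (s.buffered b)))

/-- The moves to the temporary working space. -/
noncomputable def State.firstMoves (ε : ℝ) (s : State) (b ins : ℕ) : List Move :=
  layFrom (s.pivot ε b ins) (s.buffered b) ++
    (layFrom (s.pivot ε b ins - vol (s.flushedPayload b)) (s.flushedPayload b)).reverse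

lemma flushMoves_eq (s : State) (b ins : ℕ) :
    s.flushMoves ε b ins = s.firstMoves ε b ins ++ s.finalMoves ε b := by
  simp only [State.flushMoves, State.firstMoves, State.finalMoves, State.flushedPayload,
    List.append_assoc]

lemma Shape.of_mem_finalMoves (h : Shape ε ex s.region s.tailCap s.tail s.maxLen D) {b : ℕ}
    {m : Move} (hm : m ∈ s.finalMoves ε b) :
    b ≤ sizeClass m.size ∧ (m.name, m.size) ∈ D ∧
      m.target + m.size ≤ goalStart ε s.region D b (sizeClass m.size + 1) := by
  rcases List.mem_append.1 hm with hm | hm <;>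
    obtain ⟨i, hi, hm⟩ := List.mem_flatMap.1 hm <;>
    obtain ⟨y, hy, h1, h2, h3⟩ := of_mem_layFrom hm <;>
    have hi := mem_classesFrom.1 hi <;>
    have hv := h.vol_class_le hi.1 hi.2 <;>
    rw [h.newStart_eq] at h3
  · have hc : sizeClass m.size = i := by rw [h2]; exact h.payload_class i y (mem_live.1 hy).1
    rw [hc, goalStart_succ _ _ _ hi.1]
    refine ⟨hi.1, ?_, by omega⟩
    rw [h1, h2]
    exact h.mem_of_payload (.inl (mem_live.1 hy).1) (mem_live.1 hy).2
  · have hc : sizeClass m.size = i := by rw [h2]; exact (mem_ofClass.1 hy).2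
    rw [hc, goalStart_succ _ _ _ hi.1]
    refine ⟨hi.1, ?_, by omega⟩
    rw [h1, h2]
    exact h.mem_of_buffered (mem_ofClass.1 hy).1

/-- Together with `le_pivot` this shows that the flushed payload fits to the left of T, so the
natural subtraction in the packing moves does not truncate. -/
lemma Shape.sum_cvol_le_newEnd (h : Shape ε ex s.region s.tailCap s.tail s.maxLen D) {b : ℕ} :
    vol (s.flushedPayload b) ≤ s.newEnd ε b := by
  rw [vol_flushedPayload, h.newEnd_eq, goalStart]
  have : ∑ i ∈ Finset.Ico b (sizeClass s.maxLen + 1), vol (live (s.region i).payload) ≤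
      ∑ j ∈ Finset.Ico b (sizeClass s.maxLen + 1), (cvol j D + bufLen ε (cvol j D)) := by
    refine Finset.sum_le_sum fun i hi => ?_
    rw [Finset.mem_Ico] at hi
    have := h.vol_class_le hi.1 (by omega)
    omega
  omega

/-- The summand Δ in T makes up for the length subtracted in L and L', and B contains the tail
buffer. -/
lemma le_pivot {b ins : ℕ} (hins : ins ≤ s.maxLen) (htl : ins ≤ vol s.tail) :
    s.newEnd ε b ≤ s.pivot ε b ins ∧
      s.tailStart + s.tailCap + ins ≤ s.pivot ε b ins := by
  have h1 : s.tailCap ≤ s.flushedBufs b := by rw [flushedBufs_eq]; omega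
  unfold State.pivot
  have h2 := le_max_left (s.tailStart + vol s.tail - ins) (s.newEnd ε b - ins)
  have h3 := le_max_right (s.tailStart + vol s.tail - ins) (s.newEnd ε b - ins)
  omega

lemma Shape.of_mem_firstMoves (h : Shape ε ex s.region s.tailCap s.tail s.maxLen D) {b ins : ℕ}
    (ha : s.Admissible b) (hins : ins ≤ s.maxLen) (htl : ins ≤ vol s.tail)
    {m : Move} (hm : m ∈ s.firstMoves ε b ins) :
    b ≤ sizeClass m.size ∧ (m.name, m.size) ∈ D ∧
      m.target + m.size ≤ s.pivot ε b ins + vol (s.buffered b) := by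
  rcases List.mem_append.1 hm with hm | hm
  · obtain ⟨y, hy, h1, h2, h3⟩ := of_mem_layFrom hm
    rw [h1, h2]
    exact ⟨buffered_class ha hy, h.mem_of_buffered hy, by omega⟩
  · obtain ⟨y, hy, h1, h2, h3⟩ := of_mem_layFrom (List.mem_reverse.1 hm)
    obtain ⟨i, hi, hy⟩ := List.mem_flatMap.1 hy
    have h4 := (le_pivot (ε := ε) (b := b) hins htl).1
    have h5 := h.sum_cvol_le_newEnd (b := b)
    rw [h1, h2]
    refine ⟨?_, h.mem_of_payload (.inl (mem_live.1 hy).1) (mem_live.1 hy).2, by omega⟩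
    rw [h.payload_class i y (mem_live.1 hy).1]
    exact (mem_classesFrom.1 hi).1

lemma Shape.lands (h : Shape ε ex s.region s.tailCap s.tail s.maxLen D) {b ins a n v : ℕ}
    (hD : (n, v) ∈ D) (hex : ∃ m ∈ s.finalMoves ε b, m.name = n) :
    landing (s.flushMoves ε b ins) n a + v ≤ goalStart ε s.region D b (sizeClass v + 1) := by
  rw [flushMoves_eq]
  refine landing_append_le hex fun m hm hn => ?_
  obtain ⟨-, h1, h2⟩ := h.of_mem_finalMoves hm
  rw [hn] at h1
  rwa [eq_snd_of_nodup h.nodup h1 hD] at h2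

/-- The budget is required only below the class of the triggering object: a record that fitted
nowhere cannot pay for its own class, but that class is at least the boundary and is laid out anew.
-/
lemma Shape.flush (h : Shape ε ex s.region s.tailCap s.tail s.maxLen D) {w : ℕ}
    (hcap : ∀ i < sizeClass w, (s.region i).payCap ≤ cvol i D +
      ∑ j ∈ Finset.range (sizeClass s.maxLen + 1), vol (ofClass i (s.region j).buffer) +
        vol (ofClass i s.tail))
    (hw : w ≤ s.maxLen) (hex : ex ≤ s.maxLen) (htl : ex ≤ vol s.tail) :
    Moving ε (flushReg s.region (s.boundary w)) s.tailCap (s.buffered (s.boundary w)) s.maxLen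
      ⟨s.boundary w, s.classVol, s.totalVol, s.flushMoves ε (s.boundary w) ex⟩
      (s.pivot ε (s.boundary w) ex + vol (s.buffered (s.boundary w))) D := by
  obtain ⟨ha, hbw⟩ := boundary_spec s w
  generalize s.boundary w = b at ha hbw
  have hb : b ≤ sizeClass s.maxLen := hbw.trans (sizeClass_mono hw)
  obtain ⟨hp1, hp2⟩ := le_pivot (ε := ε) (b := b) hex htl
  have htS : s.tailStart = regStart s.region (sizeClass s.maxLen + 1) := rfl
  have hmoves : ∀ m ∈ s.flushMoves ε b ex, b ≤ sizeClass m.size ∧ (m.name, m.size) ∈ D ∧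
      m.target + m.size ≤ s.pivot ε b ex + vol (s.buffered b) := by
    intro m hm
    rw [flushMoves_eq] at hm
    rcases List.mem_append.1 hm with hm | hm
    · exact h.of_mem_firstMoves ha hex htl hm
    · obtain ⟨h1, h2, h3⟩ := h.of_mem_finalMoves hm
      refine ⟨h1, h2, ?_⟩
      have h4 := goalStart_mono ε s.region D (b := b)
        (Nat.succ_le_succ (sizeClass_mono (h.size_mem _ h2).2))
      rw [h.newEnd_eq] at hp1
      simp only [Nat.succ_eq_add_one] at h4
      omega
  have hend : ∀ i x, x ∈ (s.region i).payload ∨ x ∈ (s.region i).buffer →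
      x.addr + x.size ≤ s.pivot ε b ex + vol (s.buffered b) := by
    intro i x hx
    have hi : i ≤ sizeClass s.maxLen := by
      by_contra hi
      rw [h.beyond i (by omega)] at hx
      simp at hx
    have h1 := regStart_mono s.region (Nat.succ_le_succ hi)
    have h2 : x.addr + x.size ≤ regStart s.region (i + 1) :=
      hx.elim (h.payload_end i x) (h.buffer_end i x)
    simp only [Nat.succ_eq_add_one] at h1
    omega
  have hsub : ∀ i x, x ∈ (flushReg s.region b i).payload ∨ x ∈ (flushReg s.region b i).buffer →
      x ∈ (s.region i).payload ∨ x ∈ (s.region i).buffer :=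
    fun i x hx => hx.imp flushReg_payload_subset flushReg_buffer_subset
  exact
  { nodup := h.nodup
    size_mem := h.size_mem
    content_eq := by rw [content_flushReg hb, h.content_eq]
    beyond := fun i hi => by simp [flushReg, h.beyond i hi]
    payload_class := fun i x hx => h.payload_class i x (flushReg_payload_subset hx)
    buffer_class := fun i x hx => h.buffer_class i x (flushReg_buffer_subset hx)
    buffer_nil := fun i hi => by rw [flushReg, if_pos hi]
    payload_live := fun i hi x hx => by
      rw [flushReg, if_pos hi] at hx
      exact (mem_live.1 hx).2
    overflow_live := fun x hx => (mem_buffered.1 hx).2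
    overflow_class := fun x hx => buffered_class ha hx
    boundary_le := hb
    low_end := fun i hi x hx => by
      rw [regStart_flushReg]
      exact (hsub i x hx).elim (h.payload_end i x) (h.buffer_end i x)
    low_fixed := fun i hi x hx hk m hm hn => by
      have h1 := h.mem_of_payload (hsub i x hx) hk
      obtain ⟨h2, h3, -⟩ := hmoves m hm
      rw [hn] at h3
      rw [eq_snd_of_nodup h.nodup h3 h1] at h2
      have h4 : sizeClass x.size ≤ i :=
        (hsub i x hx).elim (fun hx => (h.payload_class i x hx).le) (h.buffer_class i x)
      dsimp only at hi
      omega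
    bufCap_le := fun i => by
      rw [(flushReg_caps s.region b i).1, (flushReg_caps s.region b i).2]
      exact h.bufCap_le i
    buffer_vol := fun i => by
      rw [(flushReg_caps s.region b i).2]
      unfold flushReg
      split
      · simp
      · exact h.buffer_vol i
    -- By admissibility the flushed buffers hold nothing of a class below the boundary, so emptying
    -- them costs these classes none of their budget.
    payCap_le := fun i hi => by
      dsimp only at hi
      have h1 := hcap i (by omega)
      rw [vol_ofClass_eq_zero (l := s.tail) fun x hx => by have := ha.1 x hx; omega,
        add_zero] at h1
      rw [(flushReg_caps s.region b i).1]
      refine h1.trans_eq ?_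
      congr 1
      refine Finset.sum_congr rfl fun j hj => ?_
      unfold flushReg
      split
      · rename_i hj'
        rw [ofClass_nil, vol_nil]
        refine vol_ofClass_eq_zero fun x hx => ?_
        have := ha.2 j (by simpa [State.numClasses] using hj) hj' x hx
        omega
      · rfl
    classVol_eq := h.classVol_eq
    totalVol_eq := h.totalVol_eq
    moves_mem := fun m hm => (hmoves m hm).2.1
    moves_end := fun m hm => (hmoves m hm).2.2
    payload_lands := fun i hi x hx => by
      have hx' := flushReg_payload_subset hx
      rw [flushReg, if_pos hi] at hx
      have hk := (mem_live.1 hx).2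
      rw [goalStart_flushReg, ← h.payload_class i x hx']
      refine h.lands (h.mem_of_payload (.inl hx') hk) ?_
      obtain ⟨m, hm, hn⟩ := exists_mem_layFrom (s.newStart ε b i) hx
      refine ⟨m, List.mem_append.2 (.inl (List.mem_flatMap.2 ⟨i, ?_, hm⟩)), hn⟩
      refine mem_classesFrom.2 ⟨hi, ?_⟩
      by_contra hi'
      rw [h.beyond i (by omega)] at hx'
      simp at hx'
    overflow_lands := fun x hx => by
      rw [goalStart_flushReg]
      refine h.lands (h.mem_of_buffered hx) ?_
      obtain ⟨m, hm, hn⟩ := exists_mem_layFrom (s.newStart ε b (sizeClass x.size) +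
        vol (live (s.region (sizeClass x.size)).payload)) (mem_ofClass.2 ⟨hx, rfl⟩)
      refine ⟨m, List.mem_append.2 (.inr (List.mem_flatMap.2 ⟨_, ?_, hm⟩)), hn⟩
      exact mem_classesFrom.2 ⟨buffered_class ha hx,
        sizeClass_mono (h.size_mem _ (h.mem_of_buffered hx)).2⟩
    item_end := fun i x hx => hend i x (hsub i x hx)
    overflow_end := fun x hx => by
      obtain ⟨⟨i, -, -, hx⟩ | hx, hk⟩ := mem_buffered.1 hx
      · exact hend i x (.inr hx)
      · have := h.tail_end x hx
        omega
    layout_end := by rw [regStart_flushReg]; omega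
    goal_end := by
      rw [goalStart_flushReg, ← h.newEnd_eq]; dsimp only; omega }

/-- The maximum of both layout ends contributes (1 + 8ε)X and the flushed buffers, counted twice,
contribute 2 · 4εX. -/
lemma Shape.logStart_le (hε : 0 < ε) (hε' : ε ≤ 1 / 4)
    (h : Shape ε ex s.region s.tailCap s.tail s.maxLen D) {w : ℕ}
    (hm : Moving ε (flushReg s.region (s.boundary w)) s.tailCap (s.buffered (s.boundary w))
      s.maxLen ⟨s.boundary w, s.classVol, s.totalVol, s.flushMoves ε (s.boundary w) ex⟩
      (s.pivot ε (s.boundary w) ex + vol (s.buffered (s.boundary w))) D)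
    (htl : ex ≤ vol s.tail) {X : ℕ} (hX : dvol D ≤ X)
    (hlay : ((regStart s.region (sizeClass s.maxLen + 1) + s.tailCap + ex : ℕ) : ℝ) ≤
      (1 + 8 * ε) * X)
    (hbuf : ((∑ i ∈ Finset.range (sizeClass s.maxLen + 1), (s.region i).bufCap + s.tailCap : ℕ) : ℝ)
      ≤ 4 * ε * X) :
    ((s.pivot ε (s.boundary w) ex + vol (s.buffered (s.boundary w)) : ℕ) : ℝ) ≤
      (1 + 16 * ε) * X + s.maxLen := by
  have hb := hm.boundary_le
  dsimp only at hb
  have hgoal := ((budget_goalReg (ov := s.buffered (s.boundary w)) hε hm.payCap_le hm.buffer_nil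
    hm.classVol_eq hm.totalVol_eq).layout_le hε hε' (goalReg_bufCap_le hε hm.bufCap_le)
    (goalReg_buffer_vol hm.buffer_vol) (by simp)).1
  rw [regStart_goalReg hm.classVol_eq (by dsimp only; omega), goalStart_flushReg, hm.totalVol_eq,
    ← h.newEnd_eq] at hgoal
  dsimp only at hgoal
  generalize s.boundary w = b at *
  have hB : s.flushedBufs b ≤
      ∑ i ∈ Finset.range (sizeClass s.maxLen + 1), (s.region i).bufCap + s.tailCap := by
    rw [flushedBufs_eq]
    gcongr
    intro i hi
    simp at hi ⊢
    omega
  -- The excess `ex` of the overfull tail buffer is regained below from the reduction by `ex` in the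
  -- pivot.
  have hV : vol (s.buffered b) ≤ s.flushedBufs b + ex := by
    have h1 := vol_buffered_le s b
    have h2 : ∑ i ∈ Finset.Ico b (sizeClass s.maxLen + 1), vol (s.region i).buffer ≤
        ∑ i ∈ Finset.Ico b (sizeClass s.maxLen + 1), (s.region i).bufCap :=
      Finset.sum_le_sum fun i _ => h.buffer_vol i
    have h3 := h.tail_vol
    rw [flushedBufs_eq]
    omega
  have htS : s.tailStart = regStart s.region (sizeClass s.maxLen + 1) := rfl
  have hX' : (s.newEnd ε b : ℝ) ≤ (1 + 8 * ε) * X :=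
    hgoal.trans (by gcongr)
  have hT : s.pivot ε b ex + vol (s.buffered b) ≤
      max (regStart s.region (sizeClass s.maxLen + 1) + s.tailCap + ex) (s.newEnd ε b) +
        2 * (∑ i ∈ Finset.range (sizeClass s.maxLen + 1), (s.region i).bufCap + s.tailCap) +
        s.maxLen := by
    have h3 := h.tail_vol
    unfold State.pivot
    omega
  have hT' := (Nat.cast_le (α := ℝ)).2 hT
  refine hT'.trans ?_
  have hmax : ((max (regStart s.region (sizeClass s.maxLen + 1) + s.tailCap + ex)
      (s.newEnd ε b) : ℕ) : ℝ) ≤ (1 + 8 * ε) * X := by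
    rw [Nat.cast_max]; exact max_le hlay hX'
  rw [Nat.cast_add, Nat.cast_add, Nat.cast_mul, Nat.cast_two]
  linarith

end StartFlush

/-! ### Growth of the maximum length -/

lemma content_extend {reg : ℕ → Region} {m n : ℕ} (tl : List Item) (hmn : m ≤ n)
    (h : ∀ i, m < i → reg i = ⟨0, 0, [], []⟩) : content reg n tl = content reg m tl := by
  rw [content, content, sum_range_extend hmn fun i hi => by simp [h i hi]]

lemma regStart_extend {reg : ℕ → Region} {m n : ℕ} (hmn : m ≤ n)
    (h : ∀ i, m < i → reg i = ⟨0, 0, [], []⟩) : regStart reg (n + 1) = regStart reg (m + 1) := by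
  rw [regStart, regStart, sum_range_extend hmn fun i hi => by simp [h i hi]]

/-- Regions of classes that come into existence have length zero, so no address changes. -/
lemma Shape.mono_maxLen {ε : ℝ} {ex reg tc tl Δ Δ' D} (h : Shape ε ex reg tc tl Δ D)
    (hΔ : Δ ≤ Δ') : Shape ε ex reg tc tl Δ' D where
  nodup := h.nodup
  size_mem p hp := ⟨(h.size_mem p hp).1, (h.size_mem p hp).2.trans hΔ⟩
  content_eq := by rw [content_extend tl (sizeClass_mono hΔ) h.beyond, h.content_eq]
  beyond i hi := h.beyond i ((sizeClass_mono hΔ).trans_lt hi)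
  payload_class := h.payload_class
  buffer_class := h.buffer_class
  payload_end := h.payload_end
  buffer_end := h.buffer_end
  tail_end := by rw [regStart_extend (sizeClass_mono hΔ) h.beyond]; exact h.tail_end
  bufCap_le := h.bufCap_le
  buffer_vol := h.buffer_vol
  tail_vol := h.tail_vol

lemma Budget.mono_maxLen {ε : ℝ} {reg tc tl Δ Δ' M} (h : Budget ε reg tc tl Δ M) (hΔ : Δ ≤ Δ')
    (hb : ∀ i, sizeClass Δ < i → reg i = ⟨0, 0, [], []⟩) : Budget ε reg tc tl Δ' M where
  payCap_le i := by
    rw [← sum_range_extend (sizeClass_mono hΔ) fun j hj => by simp [hb j hj]]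
    exact h.payCap_le i
  tailCap_le := by
    rw [← sum_range_extend (sizeClass_mono hΔ) fun j hj => by simp [hb j hj]]
    exact h.tailCap_le

lemma Moving.mono_maxLen {ε : ℝ} {reg tc ov Δ Δ' p T D} (h : Moving ε reg tc ov Δ p T D)
    (hΔ : Δ ≤ Δ') : Moving ε reg tc ov Δ' p T D where
  nodup := h.nodup
  size_mem p hp := ⟨(h.size_mem p hp).1, (h.size_mem p hp).2.trans hΔ⟩
  content_eq := by rw [content_extend [] (sizeClass_mono hΔ) h.beyond, h.content_eq]
  beyond i hi := h.beyond i ((sizeClass_mono hΔ).trans_lt hi)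
  payload_class := h.payload_class
  buffer_class := h.buffer_class
  buffer_nil := h.buffer_nil
  payload_live := h.payload_live
  overflow_live := h.overflow_live
  overflow_class := h.overflow_class
  boundary_le := h.boundary_le.trans (sizeClass_mono hΔ)
  low_end := h.low_end
  low_fixed := h.low_fixed
  bufCap_le := h.bufCap_le
  buffer_vol := h.buffer_vol
  payCap_le i hi := by
    rw [← sum_range_extend (sizeClass_mono hΔ) fun j hj => by simp [h.beyond j hj]]
    exact h.payCap_le i hi
  classVol_eq := h.classVol_eq
  totalVol_eq := h.totalVol_eq
  moves_mem := h.moves_mem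
  moves_end := h.moves_end
  payload_lands := h.payload_lands
  overflow_lands := h.overflow_lands
  item_end := h.item_end
  overflow_end := h.overflow_end
  layout_end := by rw [regStart_extend (sizeClass_mono hΔ) h.beyond]; exact h.layout_end
  goal_end := by
    refine le_trans (le_of_eq ?_) h.goal_end
    congr 1
    unfold goalStart
    congr 1
    refine (Finset.sum_subset (Finset.Ico_subset_Ico_right
      (Nat.succ_le_succ (sizeClass_mono hΔ))) fun j hj hj' => ?_).symm
    have h1 : cvol j D = 0 := cvol_eq_zero fun q hq => by
      have := sizeClass_mono (h.size_mem q hq).2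
      simp only [Finset.mem_Ico] at hj hj'
      omega
    simp [h1, bufLen]

/-! ### The log and the account of the work done -/

/-- Carrying out the items of a log in order leads from the active objects `D` to `A`. -/
def Replays : Directory → List Item → Directory → Prop
  | D, [], A => D = A
  | D, x :: xs, A =>
    if x.kind = .live then
      x.name ∉ D.map Prod.fst ∧ Replays (D.update (.insert x.name x.size)) xs A
    else (x.name, x.size) ∈ D ∧ Replays (D.update (.delete x.name)) xs A

lemma Replays.append_singleton {D A A' : Directory} {l : List Item} {x : Item}
    (h : Replays D l A) (hx : Replays A [x] A') : Replays D (l ++ [x]) A' := by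
  induction l generalizing D with
  | nil => obtain rfl : D = A := h; exact hx
  | cons y l ih =>
    simp only [Replays, List.cons_append] at h ⊢
    split
    · rw [if_pos ‹_›] at h; exact ⟨h.1, ih h.2⟩
    · rw [if_neg ‹_›] at h; exact ⟨h.1, ih h.2⟩

/-- The account of a flush that found the volume `Vf` and during which requests of total length
`W` have been put into the log, while `rem` is the volume of the steps still to be done and `k`
the volume of the work still due; `Va` is the current active volume, `pend` the length of the
object whose deletion triggered the flush, and the log occupies the cells `ls, …, le - 1`. -/
structure Ledger (ε : ℝ) (eager : Bool) (k Va Δ pend : ℕ) (log : List Item) (ls le Vf W rem : ℕ) :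
    Prop where
  end_eq : le = ls + W
  start_le : (ls : ℝ) ≤ (1 + 16 * ε) * (Vf + pend : ℕ) + Δ
  vol_le : Vf ≤ Va + W
  -- The whole flush costs at most 2V_f + W, and at least (4/ε)W - k of it has been done.
  work_le : 4 / ε * W + rem ≤ 2 * Vf + W + k
  -- At the trigger, (2/ε)·pend is at most 3V_f + k and the moves cost at most 2V_f.
  pend_le : eager = true → 2 / ε * pend + rem ≤ 5 * Vf + k
  -- Everything logged before the last item fits into the new tail buffer.
  fits : ∀ l x, log = l ++ [x] → W ≤ bufLen ε Vf + x.size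
  log_end : ∀ x ∈ log, x.addr + x.size ≤ le
  log_size : ∀ x ∈ log, 1 ≤ x.size ∧ x.size ≤ Δ

lemma Ledger.advance {ε : ℝ} {eager k Va Δ pend log ls le Vf W rem} {log' : List Item} {v : ℕ}
    (h : Ledger ε eager k Va Δ pend log ls le Vf W (v + rem)) (hl : log' <:+ log) :
    Ledger ε eager (k - v) Va Δ pend log' ls le Vf W rem := by
  have hk : (k : ℝ) ≤ (k - v : ℕ) + v := by
    exact_mod_cast (by omega : k ≤ k - v + v)
  exact
  { end_eq := h.end_eq
    start_le := h.start_le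
    vol_le := h.vol_le
    work_le := by have := h.work_le; push_cast at this; linarith
    pend_le := fun he => by have := h.pend_le he; push_cast at this; linarith
    fits := fun l x hx => by
      obtain ⟨t, rfl⟩ := hl
      exact h.fits (t ++ l) x (by rw [hx, List.append_assoc])
    log_end := fun x hx => h.log_end x (hl.subset hx)
    log_size := fun x hx => h.log_size x (hl.subset hx) }

lemma log_vol_le {ε : ℝ} (hε : 0 < ε) (hε' : ε ≤ 1 / 4) {W V : ℝ} (hW : 0 ≤ W)
    (h : 4 / ε * W ≤ 2 * V + W) : W ≤ ε * V := by
  have h1 : 4 * W ≤ ε * (2 * V + W) := by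
    have := mul_le_mul_of_nonneg_left h hε.le
    rwa [show ε * (4 / ε * W) = 4 * W by field_simp] at this
  nlinarith

lemma Ledger.log_le {ε : ℝ} {eager Va Δ pend log ls le Vf W rem} (hε : 0 < ε) (hε' : ε ≤ 1 / 4)
    (h : Ledger ε eager 0 Va Δ pend log ls le Vf W rem) : (W : ℝ) ≤ ε * Vf := by
  have := h.work_le
  have h1 : (0 : ℝ) ≤ rem := by positivity
  refine log_vol_le hε hε' (by positivity) ?_
  push_cast at this
  linarith

lemma le_workVolume (ε : ℝ) (w : ℕ) : 4 / ε * w ≤ workVolume ε w := by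
  unfold workVolume
  push_cast
  exact (Nat.lt_floor_add_one _).le

/-- With no work due, the old log satisfies W ≤ εV_f, and as W is an integer also W ≤ ⌊εV_f⌋; this
is `fits` for the item now appended. The new work pays for the growth of W and of the outstanding
volume. -/
lemma Ledger.push {ε : ℝ} {eager Va Va' Δ Δ' pend log ls le Vf W rem} {x : Item} (hε : 0 < ε)
    (hε' : ε ≤ 1 / 4) (h : Ledger ε eager 0 Va Δ pend log ls le Vf W rem) (hΔ : Δ ≤ Δ')
    (hV : Va ≤ Va' + x.size) (ha : x.addr = le) (hx : 1 ≤ x.size ∧ x.size ≤ Δ') :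
    Ledger ε eager (workVolume ε x.size) Va' Δ' pend (log ++ [x]) ls (le + x.size) Vf
      (W + x.size) (rem + x.size) := by
  have hk := le_workVolume ε x.size
  have hk' : (x.size : ℝ) ≤ workVolume ε x.size := by
    refine le_trans ?_ hk
    have : 1 ≤ 4 / ε := by rw [le_div_iff₀ hε]; linarith
    nlinarith [(Nat.cast_nonneg x.size : (0 : ℝ) ≤ x.size)]
  have hΔ' : (Δ : ℝ) ≤ Δ' := by exact_mod_cast hΔ
  exact
  { end_eq := by rw [h.end_eq, add_assoc]
    start_le := by linarith [h.start_le]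
    vol_le := by have := h.vol_le; omega
    work_le := by have := h.work_le; push_cast at this ⊢; linarith
    pend_le := fun he => by have := h.pend_le he; push_cast at this ⊢; linarith
    fits := fun l y hy => by
      obtain ⟨-, hy⟩ := List.append_inj' hy rfl
      obtain rfl : x = y := by simpa using hy
      have : W ≤ bufLen ε Vf := Nat.le_floor (h.log_le hε hε')
      omega
    log_end := fun y hy => by
      rcases List.mem_append.1 hy with hy | hy
      · have := h.log_end y hy; omega
      · rw [List.mem_singleton.1 hy, ha]
    log_size := fun y hy => by
      rcases List.mem_append.1 hy with hy | hy
      · exact ⟨(h.log_size y hy).1, (h.log_size y hy).2.trans hΔ⟩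
      · rw [List.mem_singleton.1 hy]; exact hx }

/-! ### The invariant -/

/-- The state of affairs while a flush is moving objects. -/
def MovingInv (ε : ℝ) (eager : Bool) (k : ℕ) (s : State) (p : Plan) : Prop :=
  ∃ D : Directory, Moving ε s.region s.tailCap s.overflow s.maxLen p s.logStart D ∧
    Replays D s.log s.active ∧ s.tail = [] ∧
    Ledger ε eager k (dvol s.active) s.maxLen s.pending s.log s.logStart s.logEnd (dvol D)
      (vol s.log) (moveVol p.moves + vol s.log)

/-- The state of affairs while the contents of the log are moved to the buffers. -/
def DrainInv (ε : ℝ) (eager : Bool) (k : ℕ) (s : State) : Prop :=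
  ∃ (D : Directory) (Vf W : ℕ), Shape ε 0 s.region s.tailCap s.tail s.maxLen D ∧
    Budget ε s.region s.tailCap s.tail s.maxLen D ∧ Replays D s.log s.active ∧
    s.overflow = [] ∧ s.tailCap = bufLen ε Vf ∧ vol s.tail + vol s.log ≤ W ∧
    regStart s.region (sizeClass s.maxLen + 1) + s.tailCap ≤ s.logStart ∧
    Ledger ε eager k (dvol s.active) s.maxLen s.pending s.log s.logStart s.logEnd Vf W (vol s.log)

/-- The state of affairs if no flush is in progress. -/
def IdleInv (ε : ℝ) (s : State) : Prop :=
  Shape ε 0 s.region s.tailCap s.tail s.maxLen s.active ∧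
    Budget ε s.region s.tailCap s.tail s.maxLen s.active ∧ s.overflow = [] ∧ s.log = []

/-- The invariant of the data structure, where work of volume `k` is still due. -/
def PhaseInv (ε : ℝ) (eager : Bool) (k : ℕ) (s : State) : Prop :=
  match s.phase with
  | .idle => IdleInv ε s
  | .moving p => p.moves ≠ [] ∧ MovingInv ε eager k s p
  | .draining => s.log ≠ [] ∧ DrainInv ε eager k s

/-- The second claim lets `step_draining` conclude that no new flush was triggered. -/
lemma settle_draining {ε : ℝ} {eager : Bool} {k : ℕ} {s : State} (hs : s.phase = .draining)
    (h : DrainInv ε eager k s) :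
    PhaseInv ε eager k s.finish ∧ ∀ p, s.finish.phase ≠ .moving p := by
  unfold State.finish
  rw [hs]
  cases hl : s.log with
  | nil =>
    obtain ⟨D, Vf, W, h1, h2, h3, h4, -⟩ := h
    rw [hl] at h3
    obtain rfl : D = s.active := h3
    exact ⟨⟨h1, h2, h4, rfl⟩, by simp⟩
  | cons x xs => simpa [PhaseInv, hs, hl] using h

lemma Moving.install_drain {ε : ℝ} {eager : Bool} {k : ℕ} {s : State} {p : Plan} (hε : 0 < ε)
    (hm : p.moves = []) (h : MovingInv ε eager k s p) : DrainInv ε eager k (s.install ε p) := by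
  obtain ⟨D, h1, h2, h3, h4⟩ := h
  refine ⟨D, dvol D, vol s.log, h1.install hε hm, ?_, h2, rfl, ?_, ?_, ?_, ?_⟩
  · exact budget_goalReg hε h1.payCap_le h1.buffer_nil h1.classVol_eq h1.totalVol_eq
  · exact congrArg (bufLen ε) h1.totalVol_eq
  · simp [State.install]
  · have := h1.goal_end
    rw [← regStart_goalReg (ov := s.overflow) h1.classVol_eq (h1.boundary_le.trans (by omega)),
      ← h1.totalVol_eq] at this
    exact this
  · rw [hm, moveVol_nil, zero_add] at h4
    exact h4

lemma settle_moving {ε : ℝ} {eager : Bool} {k : ℕ} {s : State} {p : Plan} (hε : 0 < ε)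
    (hs : s.phase = .moving p) (h : MovingInv ε eager k s p) :
    PhaseInv ε eager k (s.settle ε) := by
  unfold State.settle
  rw [hs]
  dsimp only
  split
  · rename_i hm
    exact (settle_draining rfl (Moving.install_drain hε (List.isEmpty_iff.1 hm) h)).1
  · rename_i hm
    rw [List.isEmpty_iff] at hm
    simpa [PhaseInv, hs] using ⟨hm, h⟩

/-! ### Carrying out a request -/

lemma startFlush_inv {ε : ℝ} {eager : Bool} {k : ℕ} {s : State} {w : ℕ} {isInsert : Bool}
    {ex pend : ℕ} (hε : 0 < ε) (hε' : ε ≤ 1 / 4) (hex : ex = if isInsert then w else 0)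
    (hpend : pend = if isInsert then 0 else w)
    (h : Shape ε ex s.region s.tailCap s.tail s.maxLen s.active)
    (hcap : ∀ i < sizeClass w, (s.region i).payCap ≤ cvol i s.active +
      ∑ j ∈ Finset.range (sizeClass s.maxLen + 1), vol (ofClass i (s.region j).buffer) +
        vol (ofClass i s.tail))
    (hw : w ≤ s.maxLen) (htl : ex ≤ vol s.tail) (hlog : s.log = [])
    (hlay : ((regStart s.region (sizeClass s.maxLen + 1) + s.tailCap + ex : ℕ) : ℝ) ≤
      (1 + 8 * ε) * (dvol s.active + pend : ℕ))
    (hbuf : ((∑ i ∈ Finset.range (sizeClass s.maxLen + 1), (s.region i).bufCap + s.tailCap : ℕ) : ℝ)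
      ≤ 4 * ε * (dvol s.active + pend : ℕ))
    (hwork : eager = true → 2 / ε * w ≤ 3 * dvol s.active + k) :
    ∃ p, (s.startFlush ε w isInsert).phase = .moving p ∧
      MovingInv ε eager k (s.startFlush ε w isInsert) p := by
  have hex' : ex ≤ s.maxLen := by rw [hex]; split <;> omega
  have hm := h.flush hcap hw hex' htl
  have hls := h.logStart_le hε hε' hm htl (X := dvol s.active + pend) (by omega) hlay hbuf
  have hmv := h.moveVol_flushMoves_le hm.boundary_le ex
  have hmv' : (moveVol (s.flushMoves ε (s.boundary w) ex) : ℝ) ≤ 2 * dvol s.active := by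
    exact_mod_cast hmv
  have hp : pend ≤ w := by rw [hpend]; split <;> omega
  have hp' : 2 / ε * pend ≤ 2 / ε * w := by gcongr
  subst hex
  refine ⟨_, rfl, s.active, hm, ?_, rfl, ?_⟩
  · simp [State.startFlush, hlog, Replays]
  · exact
    { end_eq := by simp [State.startFlush, hlog]
      start_le := by
        simp only [State.startFlush, ← hpend]
        exact hls
      vol_le := by simp [State.startFlush]
      work_le := by
        simp only [State.startFlush, hlog]
        simp only [vol_nil, Nat.cast_zero, add_zero, mul_zero, zero_add]
        have : (0 : ℝ) ≤ k := by positivity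
        linarith
      pend_le := fun he => by
        have := hwork he
        simp only [State.startFlush, hlog, ← hpend]
        simp only [vol_nil, add_zero]
        linarith
      fits := fun l x hx => by simp [State.startFlush, hlog] at hx
      log_end := fun x hx => by simp [State.startFlush, hlog] at hx
      log_size := fun x hx => by simp [State.startFlush, hlog] at hx }

/-- The result `r` of carrying out a request of length `w` in the state `s`, the objects being
those of `D` afterwards: either an item has been stored in a buffer, or there was no place for it
in the tail buffer and a flush has been triggered. -/
def Performed (ε : ℝ) (s : State) (w : ℕ) (D : Directory) (r : State) : Prop :=
  (∃ reg tl, r = { s with region := reg, tail := tl, overflow := [] } ∧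
    Shape ε 0 reg s.tailCap tl s.maxLen D ∧ Budget ε reg s.tailCap tl s.maxLen D ∧
    vol tl ≤ vol s.tail + w ∧ ∀ i, regStart reg i = regStart s.region i) ∨
  s.tailCap < vol s.tail + w ∧ ∀ (eager : Bool) (k : ℕ), s.log = [] → s.active = D →
    (eager = true → 2 / ε * w ≤ 3 * dvol s.active + k) →
    ∃ p, r.phase = .moving p ∧ MovingInv ε eager k r p

lemma performInsert_spec {ε : ℝ} {s : State} {D : Directory} {n w : ℕ} (hε : 0 < ε)
    (hε' : ε ≤ 1 / 4) (h : Shape ε 0 s.region s.tailCap s.tail s.maxLen D)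
    (hb : Budget ε s.region s.tailCap s.tail s.maxLen D) (hov : s.overflow = [])
    (hn : n ∉ D.map Prod.fst) (hw : 1 ≤ w ∧ w ≤ s.maxLen) :
    Performed ε s w (D.update (.insert n w)) (s.performInsert ε n w) := by
  have hD : ((D.update (.insert n w) : Directory) : Multiset (ℕ × ℕ)) = (n, w) ::ₘ ↑D := rfl
  have hnd : (((D.update (.insert n w) : Directory) : Multiset (ℕ × ℕ)).map Prod.fst).Nodup := by
    rw [hD, Multiset.map_cons, Multiset.nodup_cons]
    exact ⟨by simpa using hn, h.nodup⟩
  have hsz : ∀ p ∈ ((D.update (.insert n w) : Directory) : Multiset (ℕ × ℕ)),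
      1 ≤ p.2 ∧ p.2 ≤ s.maxLen := by
    intro p hp
    rw [hD, Multiset.mem_cons] at hp
    rcases hp with rfl | hp
    · exact hw
    · exact h.size_mem p hp
  have hkey : ∀ a, key [(⟨n, w, a, .live⟩ : Item)] + (D : Multiset (ℕ × ℕ)) =
      ((D.update (.insert n w) : Directory) : Multiset (ℕ × ℕ)) := by
    intro a; rw [hD, key_singleton]; simp
  -- `tryStore_some` consumes one copy of the object from the budget. An insertion needs no new
  -- capacity, so the budget is padded by two copies: one is consumed, one is the new active object.
  have hb' : Budget ε s.region s.tailCap s.tail s.maxLen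
      ((n, w) ::ₘ ((D.update (.insert n w) : Directory) : Multiset (ℕ × ℕ))) := by
    have := hb.mono (N := {(n, w), (n, w)}) hε
    rw [hD]
    convert this using 1
    simp [Multiset.insert_eq_cons]
  unfold State.performInsert Performed
  cases hs : s.tryStore ⟨n, w, 0, .live⟩ with
  | some s' =>
    left
    obtain ⟨reg, tl, rfl, h1, h2, h3, h4⟩ := tryStore_some h hb' (hkey 0) hnd hsz hs
    exact ⟨reg, tl, by rw [← hov], h1, h2, h3, h4⟩
  | none =>
    right
    refine ⟨?_, fun eager k hlog hact hwork => ?_⟩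
    · by_contra hlt
      exact tryStore_ne_none (by simpa using hlt) hs
    · have hl := hb.layout_le hε hε' h.bufCap_le h.buffer_vol (by simpa using h.tail_vol)
      have hV : dvol s.active = w + dvol D := by rw [hact, hD, dvol_cons]
      refine startFlush_inv (ex := w) (pend := 0) hε hε' (by simp) (by simp) ?_ ?_ hw.2 ?_ hlog
        ?_ ?_ hwork
      · change Shape ε w s.region s.tailCap _ s.maxLen s.active
        rw [hact]
        exact h.pushTail (by omega) (by have := h.tail_vol; simp at this ⊢; omega) rfl (hkey _)
          hnd hsz
      · intro i hi
        have := hb.payCap_le i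
        change (s.region i).payCap ≤ cvol i s.active + _ + vol (ofClass i (s.tail ++ _))
        rw [hact, hD, cvol_cons, ofClass_append, vol_append]
        refine this.trans ?_
        change _ ≤ _ + ∑ j ∈ Finset.range (sizeClass s.maxLen + 1), vol (ofClass i (s.region j).buffer)
          + _
        omega
      · simp [State.pushTail]
      · change ((regStart s.region (sizeClass s.maxLen + 1) + s.tailCap + w : ℕ) : ℝ) ≤
          (1 + 8 * ε) * (dvol s.active + 0 : ℕ)
        rw [hV]
        have := hl.1
        push_cast at this ⊢
        have : 0 ≤ ε * w := by positivity
        linarith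
      · change ((∑ i ∈ Finset.range (sizeClass s.maxLen + 1), (s.region i).bufCap +
          s.tailCap : ℕ) : ℝ) ≤ 4 * ε * (dvol s.active + 0 : ℕ)
        rw [hV]
        refine hl.2.trans ?_
        gcongr
        omega

lemma coe_update_delete (D : Directory) (n : ℕ) :
    ((D.update (.delete n) : Directory) : Multiset (ℕ × ℕ)) =
      (D : Multiset (ℕ × ℕ)).filter fun p => p.1 ≠ n := by
  simp [Directory.update]

lemma markDead_eq {s : State} (n : ℕ) (hov : s.overflow = []) :
    s.markDead n =
      { s with region := mapReg (bury n) s.region, tail := s.tail.map (bury n), overflow := [] } := by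
  unfold State.markDead State.mapItems
  rw [hov]
  rfl

lemma performDelete_spec {ε : ℝ} {s : State} {D : Directory} {n w : ℕ} (hε : 0 < ε)
    (hε' : ε ≤ 1 / 4) (h : Shape ε 0 s.region s.tailCap s.tail s.maxLen D)
    (hb : Budget ε s.region s.tailCap s.tail s.maxLen D) (hov : s.overflow = [])
    (hn : (n, w) ∈ D) :
    Performed ε s w (D.update (.delete n)) (s.performDelete ε n w) := by
  have hsplit := filter_of_mem h.nodup (Multiset.mem_coe.2 hn)
  have h' := h.bury n
  have hb' := hb.bury n
  rw [← coe_update_delete] at h' hsplit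
  have hw := h.size_mem _ (Multiset.mem_coe.2 hn)
  unfold State.performDelete Performed
  rw [markDead_eq n hov]
  set s₁ : State :=
    { s with region := mapReg (bury n) s.region, tail := s.tail.map (bury n), overflow := [] }
    with hs₁
  cases hs : s₁.tryStore ⟨n, w, 0, .record⟩ with
  | some s' =>
    left
    have hb'' : Budget ε s₁.region s₁.tailCap s₁.tail s₁.maxLen
        ((n, w) ::ₘ ((D.update (.delete n) : Directory) : Multiset (ℕ × ℕ))) := by
      rw [hsplit]; exact hb'
    obtain ⟨reg, tl, rfl, h1, h2, h3, h4⟩ := tryStore_some (s := s₁) h' hb''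
      (by simp [key_singleton]) h'.nodup h'.size_mem hs
    refine ⟨reg, tl, rfl, h1, h2, ?_, h4⟩
    simpa [hs₁, vol_map _ (bury_size n)] using h3
  | none =>
    right
    refine ⟨?_, fun eager k hlog hact hwork => ?_⟩
    · by_contra hlt
      refine tryStore_ne_none ?_ hs
      simpa [hs₁, vol_map _ (bury_size n)] using hlt
    · have hl := hb'.layout_le hε hε' h'.bufCap_le h'.buffer_vol (by simpa using h'.tail_vol)
      -- The old layout is paid for by the volume before the deletion, which is why the deleted
      -- length enters the bound on the start of the log.
      have hV : dvol D = dvol s.active + w := by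
        rw [hact, ← hsplit, dvol_cons, add_comm]
      refine startFlush_inv (s := s₁) (ex := 0) (pend := w) hε hε' (by simp) (by simp) ?_ ?_ hw.2
        (Nat.zero_le _) hlog ?_ ?_ hwork
      · change Shape ε 0 s₁.region s₁.tailCap s₁.tail s₁.maxLen s.active
        rw [hact]
        exact h'
      · intro i hi
        have := hb'.payCap_le i
        rw [← hsplit, cvol_cons, if_neg (by dsimp only; omega), zero_add, ← hact] at this
        exact this
      · change ((_ : ℕ) : ℝ) ≤ (1 + 8 * ε) * (dvol s.active + w : ℕ)
        rw [← hV]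
        exact hl.1
      · change ((_ : ℕ) : ℝ) ≤ 4 * ε * (dvol s.active + w : ℕ)
        rw [← hV]
        exact hl.2

/-! ### The steps of a flush -/

lemma settle_eq_finish {ε : ℝ} {s : State} (hs : s.phase = .draining) :
    s.settle ε = s.finish := by
  unfold State.settle; rw [hs]

/-- The last log item, of length w, is part of the log that paid (4/ε)W. From V ≤ Va + W and W ≤ V/4
+ w one gets 2V + W ≤ 3Va + 4w, and half of (4/ε)w, being at least 8w, absorbs the term 4w. -/
lemma trigger_bound {ε w W V Va k k' : ℝ} (hε : 0 < ε) (hε' : ε ≤ 1 / 4) (hw : 0 ≤ w)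
    (hV : 0 ≤ V) (hwork : 4 / ε * W + w ≤ 2 * V + W + k) (hfit : W ≤ ε * V + w) (hwW : w ≤ W)
    (hvol : V ≤ Va + W) (hk : k ≤ k' + w) : 2 / ε * w ≤ 3 * Va + k' := by
  have h1 : ε * V ≤ V / 4 := by nlinarith
  have h2 : 4 / ε * w ≤ 4 / ε * W := by gcongr
  have h3 : 8 * w ≤ 2 / ε * w := by
    gcongr
    rw [le_div_iff₀ hε]; linarith
  have h4 : 4 / ε * w = 2 / ε * w + 2 / ε * w := by ring
  linarith

lemma step_draining {ε : ℝ} {eager : Bool} {k : ℕ} {s : State} {x : Item} {xs : List Item}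
    (hε : 0 < ε) (hε' : ε ≤ 1 / 4) (hs : s.phase = .draining) (hl : s.log = x :: xs)
    (h : DrainInv ε eager k s) {r : State} {D' : Directory}
    (hr : Performed ε { s with log := xs } x.size D' r) (hD' : Replays D' xs s.active) :
    PhaseInv ε eager (if triggered s (r.settle ε) && !eager then 0 else k - x.size)
      (r.settle ε) := by
  obtain ⟨D, Vf, W, h1, h2, h3, h4, h5, h6, h7, h8⟩ := h
  rw [hl, vol_cons] at h6 h8
  rcases hr with ⟨reg, tl, hr, g1, g2, g3, g4⟩ | ⟨g1, g2⟩
  · have hrp : r.phase = .draining := by rw [hr]; exact hs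
    have hd : DrainInv ε eager (k - x.size) r := by
      rw [hr]
      refine ⟨D', Vf, W, g1, g2, hD', rfl, h5, ?_, ?_, h8.advance (List.suffix_cons x xs)⟩
      · change vol tl + vol xs ≤ W
        dsimp only at g3
        omega
      · exact (congrArg (· + s.tailCap) (g4 _)).trans_le h7
    have hp := settle_draining hrp hd
    rw [settle_eq_finish hrp]
    have ht : triggered s r.finish = false := by
      unfold triggered
      rw [hs]
      split
      · rename_i p _ hp'
        exact absurd hp' (hp.2 p)
      · rfl
    rw [ht]
    simpa using hp.1
  · dsimp only at g1
    -- If an item y came last after x, then `fits` would leave room for x in the tail buffer, which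
    -- holds nothing but items that came from this log.
    have hxs : xs = [] := by
      rcases List.eq_nil_or_concat xs with h | ⟨l, y, hy⟩
      · exact h
      · rw [List.concat_eq_append] at hy
        have := h8.fits (x :: l) y (by rw [hy]; rfl)
        rw [hy] at h6
        simp only [vol_append, vol_cons, vol_nil] at h6
        omega
    subst hxs
    have hfit := h8.fits [] x rfl
    have hfit' : (W : ℝ) ≤ ε * Vf + x.size := by
      have h9 : (W : ℝ) ≤ bufLen ε Vf + x.size := by exact_mod_cast hfit
      linarith [bufLen_le hε Vf]
    -- In the lazy variant the rest of the work is forfeited, so nothing is due. In the eager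
    -- variant it goes to the new flush.
    obtain ⟨p, hp, hm⟩ := g2 eager (if triggered s (r.settle ε) && !eager then 0 else k - x.size)
      rfl hD'.symm (by
        rintro rfl
        simp only [Bool.not_true, Bool.and_false, Bool.false_eq_true, if_false]
        have hw := h8.work_le
        simp only [vol_nil, add_zero] at hw
        have hvol : (Vf : ℝ) ≤ dvol s.active + W := by exact_mod_cast h8.vol_le
        have hwW : x.size ≤ W := by omega
        exact trigger_bound hε hε' (by positivity) (by positivity) hw hfit'
          (by exact_mod_cast hwW) hvol
          (by exact_mod_cast (by omega : k ≤ k - x.size + x.size)))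
    exact settle_moving hε hp hm

lemma step_inv {ε : ℝ} {eager : Bool} {k : ℕ} {s : State} (hε : 0 < ε) (hε' : ε ≤ 1 / 4)
    (hs : s.phase ≠ .idle) (h : PhaseInv ε eager k s) :
    1 ≤ (s.step ε).2 ∧
      PhaseInv ε eager (if triggered s (s.step ε).1 && !eager then 0 else k - (s.step ε).2)
        (s.step ε).1 := by
  unfold PhaseInv at h
  cases hp : s.phase with
  | idle => exact absurd hp hs
  | moving p =>
    rw [hp] at h
    obtain ⟨hne, D, h1, h2, h3, h4⟩ := h
    obtain ⟨b, cv, tv, ms⟩ := p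
    cases ms with
    | nil => exact absurd rfl hne
    | cons m ms =>
      have hstep : s.step ε = ((({ s with phase := .moving ⟨b, cv, tv, ms⟩ } : State).relocate
          m).settle ε, m.size) := by
        unfold State.step; rw [hp]
      have ht : ∀ s', triggered s s' = false := fun s' => by unfold triggered; rw [hp]
      rw [hstep, ht]
      refine ⟨(h1.size_mem _ (h1.moves_mem m (by simp))).1, ?_⟩
      simp only [Bool.false_and, Bool.false_eq_true, if_false]
      refine settle_moving (p := ⟨b, cv, tv, ms⟩) hε rfl
        ⟨D, h1.relocate, h2, by simp [State.relocate, State.mapItems, h3], ?_⟩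
      simp only [moveVol_cons, add_assoc] at h4
      exact h4.advance (List.suffix_refl _)
  | draining =>
    rw [hp] at h
    obtain ⟨hne, h⟩ := h
    cases hl : s.log with
    | nil => exact absurd hl hne
    | cons x xs =>
      have hstep : s.step ε = ((if x.kind = .live then
          State.performInsert ε { s with log := xs } x.name x.size
          else State.performDelete ε { s with log := xs } x.name x.size).settle ε, x.size) := by
        unfold State.step; rw [hp, hl]
      rw [hstep]
      have h' := h
      obtain ⟨D, Vf, W, h1, h2, h3, h4, h5, h6, h7, h8⟩ := h'
      have hx := h8.log_size x (by simp [hl])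
      refine ⟨hx.1, ?_⟩
      rw [hl] at h3
      unfold Replays at h3
      dsimp only
      split at h3
      · rename_i hk
        simp only [if_pos hk]
        exact step_draining hε hε' hp hl h (performInsert_spec hε hε' h1 h2 h4 h3.1 hx) h3.2
      · rename_i hk
        simp only [if_neg hk]
        exact step_draining hε hε' hp hl h (performDelete_spec hε hε' h1 h2 h4 h3.1) h3.2

lemma work_inv {ε : ℝ} {eager : Bool} (hε : 0 < ε) (hε' : ε ≤ 1 / 4) (k : ℕ) (s : State)
    (h : PhaseInv ε eager k s) : PhaseInv ε eager 0 (s.work ε eager k) := by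
  induction k using Nat.strong_induction_on generalizing s with
  | _ k ih =>
    cases k with
    | zero => rwa [State.work]
    | succ k =>
      rw [State.work]
      split
      · rename_i hp
        simpa only [PhaseInv, hp] using h
      · rename_i hp
        obtain ⟨h1, h2⟩ := step_inv hε hε' hp h
        dsimp only
        split
        · rename_i ht
          rwa [if_pos ht] at h2
        · rename_i ht
          -- Every step has volume at least 1, so the shifted subtraction used for termination is
          -- the true one.
          rw [if_neg ht, show k + 1 - (s.step ε).2 = k - ((s.step ε).2 - 1) by omega] at h2
          exact ih _ (by omega) _ h2

/-! ### The active objects and the maximum length do not depend on the flushes -/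

/-- Two states agree on the active objects and on the maximum length. -/
def SameDirectory (s s' : State) : Prop := s'.active = s.active ∧ s'.maxLen = s.maxLen

lemma SameDirectory.trans {s s' s'' : State} (h : SameDirectory s s')
    (h' : SameDirectory s' s'') : SameDirectory s s'' :=
  ⟨h'.1.trans h.1, h'.2.trans h.2⟩

lemma sameDirectory_finish (s : State) : SameDirectory s s.finish := by
  unfold State.finish; split <;> exact ⟨rfl, rfl⟩

lemma sameDirectory_settle (ε : ℝ) (s : State) : SameDirectory s (s.settle ε) := by
  unfold State.settle
  split
  · split
    · exact SameDirectory.trans (s' := s.install ε _) ⟨rfl, rfl⟩ (sameDirectory_finish _)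
    · exact ⟨rfl, rfl⟩
  · exact sameDirectory_finish s

lemma sameDirectory_tryStore {s s' : State} {x : Item} (h : s.tryStore x = some s') :
    SameDirectory s s' := by
  unfold State.tryStore at h
  split at h
  · obtain rfl := Option.some.inj h; exact ⟨rfl, rfl⟩
  · split at h
    · obtain rfl := Option.some.inj h; exact ⟨rfl, rfl⟩
    · simp at h

lemma sameDirectory_performInsert (ε : ℝ) (s : State) (n w : ℕ) :
    SameDirectory s (s.performInsert ε n w) := by
  unfold State.performInsert
  split
  · exact sameDirectory_tryStore ‹_›
  · exact ⟨rfl, rfl⟩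

lemma sameDirectory_performDelete (ε : ℝ) (s : State) (n w : ℕ) :
    SameDirectory s (s.performDelete ε n w) := by
  unfold State.performDelete
  split
  · exact SameDirectory.trans (s' := s.markDead n) ⟨rfl, rfl⟩ (sameDirectory_tryStore ‹_›)
  · exact ⟨rfl, rfl⟩

lemma sameDirectory_step (ε : ℝ) (s : State) : SameDirectory s (s.step ε).1 := by
  unfold State.step
  split
  · exact SameDirectory.trans ⟨rfl, rfl⟩ (sameDirectory_settle ε _)
  · refine SameDirectory.trans ?_ (sameDirectory_settle ε _)
    split
    · exact SameDirectory.trans (s' := { s with log := _ }) ⟨rfl, rfl⟩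
        (sameDirectory_performInsert ε _ _ _)
    · exact SameDirectory.trans (s' := { s with log := _ }) ⟨rfl, rfl⟩
        (sameDirectory_performDelete ε _ _ _)
  · exact ⟨rfl, rfl⟩

lemma sameDirectory_work (ε : ℝ) (eager : Bool) (k : ℕ) (s : State) :
    SameDirectory s (s.work ε eager k) := by
  induction k using Nat.strong_induction_on generalizing s with
  | _ k ih =>
    cases k with
    | zero => rw [State.work]; exact ⟨rfl, rfl⟩
    | succ k =>
      rw [State.work]
      split
      · exact ⟨rfl, rfl⟩
      · dsimp only
        split
        · exact sameDirectory_step ε s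
        · exact (sameDirectory_step ε s).trans (ih _ (by omega) _)

lemma process_directory (ε : ℝ) (eager : Bool) (s : State) (r : Request) :
    (s.process ε eager r).active = s.active.update r ∧
      (s.process ε eager r).maxLen = r.maxLength s.maxLen := by
  set s₀ : State := { s with active := s.active.update r, maxLen := r.maxLength s.maxLen } with hs₀
  suffices h : SameDirectory s₀ (s.process ε eager r) from h
  unfold State.process
  dsimp only
  rw [← hs₀]
  split
  · have h : ∀ s₁, SameDirectory s₀ s₁ → SameDirectory s₀
        (if eager = true then (s₁.settle ε).work ε eager (workVolume ε (s.requestLength r))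
          else s₁.settle ε) := by
      intro s₁ h₁
      split
      · exact (h₁.trans (sameDirectory_settle ε _)).trans (sameDirectory_work _ _ _ _)
      · exact h₁.trans (sameDirectory_settle ε _)
    apply h
    cases r with
    | insert n w => exact sameDirectory_performInsert ε s₀ n _
    | delete n => exact sameDirectory_performDelete ε s₀ n _
  · refine SameDirectory.trans ?_ (sameDirectory_work _ _ _ _)
    cases r <;> exact ⟨rfl, rfl⟩

/-! ### Processing a request -/

/-- The active objects have distinct names, and their lengths are at least `1` and at most `Δ`. -/
def Proper (A : Directory) (Δ : ℕ) : Prop :=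
  (A.map Prod.fst).Nodup ∧ ∀ p ∈ A, 1 ≤ p.2 ∧ p.2 ≤ Δ

/-- The request `r` is legal if the active objects are those of `A`. -/
def Legal (A : Directory) : Request → Prop
  | .insert n w => 1 ≤ w ∧ n ∉ A.map Prod.fst
  | .delete n => n ∈ A.map Prod.fst

lemma Proper.update {A : Directory} {Δ : ℕ} (h : Proper A Δ) {r : Request} (hr : Legal A r) :
    Proper (A.update r) (r.maxLength Δ) := by
  cases r with
  | insert n w =>
    refine ⟨?_, ?_⟩
    · simp only [Directory.update, List.map_cons, List.nodup_cons]
      exact ⟨hr.2, h.1⟩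
    · intro p hp
      rcases List.mem_cons.1 hp with rfl | hp
      · exact ⟨hr.1, le_max_right _ _⟩
      · exact ⟨(h.2 p hp).1, (h.2 p hp).2.trans (le_max_left _ _)⟩
  | delete n =>
    exact ⟨h.1.sublist (List.filter_sublist.map _), fun p hp => h.2 p (List.mem_of_mem_filter hp)⟩

lemma mem_lengthOf {A : Directory} {n : ℕ} (h : n ∈ A.map Prod.fst) :
    (n, A.lengthOf n) ∈ A := by
  induction A with
  | nil => simp at h
  | cons p A ih =>
    obtain ⟨m, v⟩ := p
    by_cases hm : n = m
    · subst hm; simp [Directory.lengthOf]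
    · have hA : n ∈ A.map Prod.fst := by simpa [hm] using h
      have := ih hA
      have hb : (n == m) = false := by simpa using hm
      simp only [Directory.lengthOf, List.lookup_cons, hb] at this ⊢
      exact List.mem_cons_of_mem _ this

lemma dvol_update {A : Directory} {Δ : ℕ} (h : Proper A Δ) {n : ℕ} (hn : n ∈ A.map Prod.fst) :
    dvol A = A.lengthOf n + dvol (A.update (.delete n)) := by
  have := filter_of_mem (M := (A : Multiset (ℕ × ℕ))) h.1
    (Multiset.mem_coe.2 (mem_lengthOf hn))
  rw [coe_update_delete]
  nth_rw 1 [← this]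
  rw [dvol_cons]

lemma le_maxLength (r : Request) (Δ : ℕ) : Δ ≤ r.maxLength Δ := by
  cases r
  · exact le_max_left _ _
  · exact le_rfl

lemma pushLog_inv {ε : ℝ} {eager : Bool} {s : State} {A' : Directory} {Δ' : ℕ} {x : Item}
    (hε : 0 < ε) (hε' : ε ≤ 1 / 4) (hs : s.phase ≠ .idle) (h : PhaseInv ε eager 0 s)
    (hΔ : s.maxLen ≤ Δ') (hx : ∀ a, Replays s.active [{ x with addr := a }] A')
    (hV : dvol s.active ≤ dvol A' + x.size) (hsz : 1 ≤ x.size ∧ x.size ≤ Δ') :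
    PhaseInv ε eager (workVolume ε x.size)
      (State.pushLog { s with active := A', maxLen := Δ' } x) := by
  unfold PhaseInv at h ⊢
  cases hp : s.phase with
  | idle => exact absurd hp hs
  | moving p =>
    rw [hp] at h
    obtain ⟨hne, D, h1, h2, h3, h4⟩ := h
    have h5 := h4.push (x := { x with addr := s.logEnd }) hε hε' hΔ hV rfl hsz
    simp only [State.pushLog]
    refine ⟨hne, D, h1.mono_maxLen hΔ, h2.append_singleton (hx _), h3, ?_⟩
    simpa [add_assoc] using h5
  | draining =>
    rw [hp] at h
    obtain ⟨hne, D, Vf, W, h1, h2, h3, h4, h5, h6, h7, h8⟩ := h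
    have h9 := h8.push (x := { x with addr := s.logEnd }) hε hε' hΔ hV rfl hsz
    simp only [State.pushLog]
    refine ⟨by simp, D, Vf, W + x.size, h1.mono_maxLen hΔ, h2.mono_maxLen hΔ h1.beyond,
      h3.append_singleton (hx _), h4, h5, ?_, ?_, ?_⟩
    · simp only [vol_append, vol_cons, vol_nil]
      omega
    · dsimp only
      rw [regStart_extend (sizeClass_mono hΔ) h1.beyond]
      exact h7
    · simpa using h9

/-- A trigger outside a flush has its full share of work still due, which alone covers the
requirement on its length in the eager variant. -/
lemma idle_inv {ε : ℝ} {eager : Bool} {k w : ℕ} {s r : State} (hε : 0 < ε)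
    (hs : s.phase = .idle) (hl : s.log = []) (hr : Performed ε s w s.active r)
    (hk : eager = true → 4 / ε * w ≤ k) : PhaseInv ε eager k (r.settle ε) := by
  rcases hr with ⟨reg, tl, rfl, g1, g2, -, -⟩ | ⟨-, g⟩
  · simp only [State.settle, hs, State.finish, PhaseInv]
    exact ⟨g1, g2, rfl, hl⟩
  · obtain ⟨p, hp, hm⟩ := g eager k hl rfl fun he => by
      have h1 := hk he
      have h2 : (0 : ℝ) ≤ 2 / ε * w := by positivity
      have h3 : 4 / ε * w = 2 / ε * w + 2 / ε * w := by ring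
      have h4 : (0 : ℝ) ≤ dvol s.active := by positivity
      linarith
    exact settle_moving hε hp hm

lemma process_inv {ε : ℝ} {eager : Bool} {s : State} {r : Request} (hε : 0 < ε)
    (hε' : ε ≤ 1 / 4) (h : PhaseInv ε eager 0 s) (hA : Proper s.active s.maxLen)
    (hr : Legal s.active r) : PhaseInv ε eager 0 (s.process ε eager r) := by
  set s₀ : State := { s with active := s.active.update r, maxLen := r.maxLength s.maxLen } with hs₀
  unfold State.process
  dsimp only
  rw [← hs₀]
  split
  · rename_i hp
    simp only [PhaseInv, hp] at h
    obtain ⟨h1, h2, h3, h4⟩ := h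
    have h2 := h2.mono_maxLen (le_maxLength r s.maxLen) h1.beyond
    have h1 := h1.mono_maxLen (le_maxLength r s.maxLen)
    have key : ∀ s₁, Performed ε s₀ (s.requestLength r) s₀.active s₁ →
        PhaseInv ε eager 0 (if eager = true then
          (s₁.settle ε).work ε eager (workVolume ε (s.requestLength r)) else s₁.settle ε) := by
      intro s₁ h₁
      split
      · exact work_inv hε hε' _ _ (idle_inv (s := s₀) hε hp h4 h₁ fun _ => le_workVolume _ _)
      · exact idle_inv (s := s₀) hε hp h4 h₁ fun he => absurd he ‹_›
    apply key
    cases r with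
    | insert n w => exact performInsert_spec hε hε' h1 h2 h3 hr.2 ⟨hr.1, le_max_right _ _⟩
    | delete n => exact performDelete_spec hε hε' h1 h2 h3 (mem_lengthOf hr)
  · rename_i hp
    cases r with
    | insert n w =>
      refine work_inv hε hε' _ _ (pushLog_inv (x := ⟨n, w, 0, .live⟩) hε hε' hp h
        (le_maxLength _ _) (fun a => ?_) ?_ ⟨hr.1, le_max_right _ _⟩)
      · simpa [Replays] using hr.2
      · change _ ≤ dvol ((n, w) ::ₘ (s.active : Multiset (ℕ × ℕ))) + _
        rw [dvol_cons]
        omega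
    | delete n =>
      refine work_inv hε hε' _ _ (pushLog_inv (x := ⟨n, s.active.lengthOf n, 0, .record⟩) hε hε' hp
        h (le_maxLength _ _) (fun a => ?_) ?_ ?_)
      · simpa [Replays] using mem_lengthOf hr
      · rw [dvol_update hA hr]
        dsimp only
        omega
      · exact hA.2 _ (mem_lengthOf hr)

lemma init_inv (ε : ℝ) (eager : Bool) : PhaseInv ε eager 0 State.init := by
  simp only [PhaseInv, State.init, IdleInv]
  refine ⟨⟨?_, ?_, ?_, ?_, ?_, ?_, ?_, ?_, ?_, ?_, ?_, ?_⟩, ⟨?_, ?_⟩, ?_, ?_⟩ <;>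
    simp [content]

lemma run_inv {ε : ℝ} {eager : Bool} (hε : 0 < ε) (hε' : ε ≤ 1 / 4) (rs : List Request)
    (s : State) (h : PhaseInv ε eager 0 s) (hA : Proper s.active s.maxLen)
    (hv : ValidFrom s.active rs) :
    PhaseInv ε eager 0 (rs.foldl (State.process ε eager) s) ∧
      (rs.foldl (State.process ε eager) s).active = rs.foldl Directory.update s.active ∧
      (rs.foldl (State.process ε eager) s).maxLen = rs.foldl Request.maxLength s.maxLen := by
  induction rs generalizing s with
  | nil => exact ⟨h, rfl, rfl⟩
  | cons r rs ih =>
    have hr : Legal s.active r ∧ ValidFrom (s.active.update r) rs := by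
      cases r with
      | insert n w => exact ⟨⟨hv.1, hv.2.1⟩, hv.2.2⟩
      | delete n => exact hv
    obtain ⟨h1, h2⟩ := process_directory ε eager s r
    have := ih (s.process ε eager r) (process_inv hε hε' h hA hr.1)
      (by rw [h1, h2]; exact hA.update hr.1) (by rw [h1]; exact hr.2)
    rwa [h1, h2] at this

/-! ### The space bound -/

lemma IdleInv.space_le {ε : ℝ} {s : State} (hε : 0 < ε) (hε' : ε ≤ 1 / 4)
    (hs : s.phase = .idle) (h : IdleInv ε s) : (s.space : ℝ) ≤ (1 + 8 * ε) * dvol s.active := by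
  obtain ⟨h1, h2, h3, h4⟩ := h
  refine le_trans (Nat.cast_le.2 ?_) (h2.layout_le hε hε' h1.bufCap_le h1.buffer_vol h1.tail_vol).1
  unfold State.space
  rw [hs]
  refine max_le le_rfl (max_le (lastCell_le fun x hx => ?_) (Nat.zero_le _))
  rw [h3, h4, List.append_nil, List.append_nil, mem_mainItems] at hx
  rcases hx with ⟨i, hi, hx⟩ | hx
  · have h5 := regStart_mono s.region (Nat.succ_le_succ hi)
    have h6 : x.addr + x.size ≤ regStart s.region (i + 1) :=
      hx.elim (h1.payload_end i x) (h1.buffer_end i x)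
    simp only [Nat.succ_eq_add_one] at h5
    omega
  · exact h1.tail_end x hx

lemma space_le_logEnd {ε : ℝ} {eager : Bool} {s : State} (hs : s.phase ≠ .idle)
    (h : PhaseInv ε eager 0 s) : s.space ≤ s.logEnd := by
  unfold PhaseInv at h
  unfold State.space
  cases hp : s.phase with
  | idle => exact absurd hp hs
  | moving p =>
    rw [hp] at h
    obtain ⟨-, D, h1, h2, h3, h4⟩ := h
    have h5 := h4.end_eq
    refine max_le ?_ (max_le (lastCell_le fun x hx => ?_) le_rfl)
    · exact h1.layout_end.trans (by omega)
    · rw [List.mem_append, List.mem_append, mem_mainItems, h3] at hx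
      rcases hx with ((⟨i, hi, hx⟩ | hx) | hx) | hx
      · exact (h1.item_end i x hx).trans (by omega)
      · simp at hx
      · exact (h1.overflow_end x hx).trans (by omega)
      · exact h4.log_end x hx
  | draining =>
    rw [hp] at h
    obtain ⟨-, D, Vf, W, h1, h2, h3, h4, h5, h6, h7, h8⟩ := h
    have h9 := h8.end_eq
    refine max_le ?_ (max_le (lastCell_le fun x hx => ?_) le_rfl)
    · exact h7.trans (by omega)
    · rw [h4, List.append_nil, List.mem_append, mem_mainItems] at hx
      rcases hx with (⟨i, hi, hx⟩ | hx) | hx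
      · have h10 := regStart_mono s.region (Nat.succ_le_succ hi)
        have h11 : x.addr + x.size ≤ regStart s.region (i + 1) :=
          hx.elim (h1.payload_end i x) (h1.buffer_end i x)
        simp only [Nat.succ_eq_add_one] at h10
        omega
      · have := h1.tail_end x hx
        omega
      · exact h8.log_end x hx

/-- With no work due, W ≤ εV_f and V_f ≤ Va + W give V_f ≤ (1 + 2ε)Va. In the eager variant
`pend_le` gives pend ≤ (5/2)εV_f ≤ 5εVa. The coefficients of εVa then add up to at most 2 + 32 + 25
+ 2 = 61. -/
lemma Ledger.logEnd_le {ε : ℝ} {eager Va Δ pend log ls le Vf W rem} (hε : 0 < ε)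
    (hε' : ε ≤ 1 / 4) (h : Ledger ε eager 0 Va Δ pend log ls le Vf W rem) :
    (le : ℝ) ≤ (1 + 64 * ε) * (if eager then Va else Va + pend : ℕ) + Δ := by
  have hW := h.log_le hε hε'
  have hV : (Vf : ℝ) ≤ Va + W := by exact_mod_cast h.vol_le
  have hs := h.start_le
  have hle : (le : ℝ) = ls + W := by exact_mod_cast h.end_eq
  have hVa : (0 : ℝ) ≤ Va := by positivity
  have hpend : (0 : ℝ) ≤ pend := by positivity
  have hVf0 : (0 : ℝ) ≤ Vf := by positivity
  push_cast at hs
  have hεVa : 0 ≤ ε * Va := by positivity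
  have hεp : 0 ≤ ε * pend := by positivity
  have hVf2 : (Vf : ℝ) ≤ 2 * Va := by nlinarith
  have hεVf : ε * Vf ≤ 2 * (ε * Va) := by nlinarith
  have hVf : (Vf : ℝ) ≤ Va + 2 * (ε * Va) := by linarith
  cases eager with
  | false =>
    simp only [Bool.false_eq_true, if_false]
    push_cast
    linarith
  | true =>
    simp only [if_true]
    have hp := h.pend_le rfl
    have hrem : (0 : ℝ) ≤ rem := by positivity
    have hp1 : 2 / ε * pend ≤ 5 * Vf := by push_cast at hp; linarith
    have hp2 : 2 * (pend : ℝ) ≤ 5 * (ε * Vf) := by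
      have := mul_le_mul_of_nonneg_left hp1 hε.le
      rw [show ε * (2 / ε * pend) = 2 * (pend : ℝ) by field_simp] at this
      linarith
    have hp3 : ε * pend ≤ pend / 4 := by nlinarith
    linarith

end StorageRealloc

theorem mainTheorem7 :
    ∃ C : ℝ, 0 < C ∧ ∀ ε : ℝ, 0 < ε → ε ≤ 1 / 4 →
      ∀ (eager : Bool) (rs : List StorageRealloc.Request), StorageRealloc.Valid rs →
        ((StorageRealloc.run ε eager rs).space : ℝ) ≤
            (1 + C * ε) * StorageRealloc.countedVolume ε eager rs +
              StorageRealloc.longest rs ∧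
        ((StorageRealloc.run ε eager rs).phase.IsIdle →
          ((StorageRealloc.run ε eager rs).space : ℝ) ≤
            (1 + C * ε) * StorageRealloc.activeVolume rs) := by
  open StorageRealloc in
  refine ⟨64, by norm_num, fun ε hε hε' eager rs hv => ?_⟩
  obtain ⟨h, hact, hmax⟩ := run_inv hε hε' rs State.init (init_inv ε eager)
    ⟨by simp [State.init], by simp [State.init]⟩ hv
  change PhaseInv ε eager 0 (run ε eager rs) at h
  have hvol : dvol (run ε eager rs).active = activeVolume rs := congrArg dvol (congrArg _ hact)
  have hlong : (run ε eager rs).maxLen = longest rs := hmax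
  have hcount : countedVolume ε eager rs =
      if eager then activeVolume rs else activeVolume rs + (run ε eager rs).pending := rfl
  have hidle : (run ε eager rs).phase = .idle →
      ((run ε eager rs).space : ℝ) ≤ (1 + 64 * ε) * activeVolume rs := fun hp => by
    have h' := h
    simp only [PhaseInv, hp] at h'
    rw [← hvol]
    refine (h'.space_le hε hε' hp).trans ?_
    gcongr
    norm_num
  refine ⟨?_, fun hp => hidle ?_⟩
  · by_cases hp : (run ε eager rs).phase = .idle
    · refine (hidle hp).trans ((mul_le_mul_of_nonneg_left ?_ (by positivity)).trans
        (le_add_of_nonneg_right (by positivity)))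
      rw [hcount, Nat.cast_le]
      split <;> omega
    · refine (Nat.cast_le.2 (space_le_logEnd hp h)).trans ?_
      rw [hcount, ← hvol, ← hlong]
      unfold PhaseInv at h
      split at h
      · exact absurd ‹_› hp
      · obtain ⟨-, D, -, -, -, h4⟩ := h
        exact h4.logEnd_le hε hε'
      · obtain ⟨-, D, Vf, W, -, -, -, -, -, -, -, h8⟩ := h
        exact h8.logEnd_le hε hε'
  · unfold Phase.IsIdle at hp
    split at hp
    · assumption
    · exact hp.elim
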